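/- Let $M$ be a complex manifold and $E\to M$ a holomorphic vector bundle of rank $4$ or $5$. Let $\mathcal O_{\Lambda E}=\bigoplus_j\mathcal O_{\Lambda^jE}$ be the sheaf of holomorphic sections of $\Lambda E$. For $k\in\{2,4\}$ let $Der_k(\Lambda E)$ be the sheaf of ($\mathbb C$-linear, even) derivations $w$ of $\mathcal O_{\Lambda E}$ with $w(\mathcal O_{\Lambda^jE})\subset\mathcal O_{\Lambda^{j+k}E}$ for all $j$. Let $G_E$ be the sheaf of groups of automorphisms $g$ of the sheaf of algebras $\mathcal O_{\Lambda E}$ that preserve the $\mathbb Z/2$-grading and satisfy $(g-\mathrm{Id})(\mathcal O_{\Lambda^jE})\subset\bigoplus_{k\ge1}\mathcal O_{\Lambda^{j+2k}E}$ for all $j$. The group $H^0(M,Aut(E))$ of holomorphic bundle automorphisms $\varphi$ of $E$ acts on endomorphisms of $\mathcal O_{\Lambda E}$ by $\varphi.x=\Lambda\varphi\circ x\circ\Lambda\varphi^{-1}$. All cochains are Čech cochains, taken either with respect to one fixed open cover of $M$, or in the direct limit over all covers $(U_x)_{x\in M}$ with $x\in U_x$ (which gives the Čech cohomology of $M$),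 or more generally in the direct limit over any non-empty directed (under refinement) family of open covers with a common index set, where $(V_a)_a$ refines $(U_a)_a$ if $V_a\subset U_a$ for all $a$. Abelian coboundaries are $(dv)_{ij}=v_i-v_j$ and $(du)_{ijk}=u_{ij}+u_{jk}-u_{ik}$. A cocycle $g\in Z^1(M,G_E)$ satisfies $g_{ij}g_{jk}=g_{ik}$, and $g,g'\in Z^1(M,G_E)$ define the same class in the pointed set $H^1(M,G_E)$ iff $g'_{ij}=h_ig_{ij}h_j^{-1}$ for some $h\in C^0(M,G_E)$. For $u\in Z^1(M,Der_2(\Lambda E))$ let $c_u\in C^2$ be the component of $$\big(\exp(u_{ij})\exp(u_{jk})\exp(u_{ik})^{-1}\big)_{ijk}$$ that raises the degree by $4$, let $$\tilde Z^1(M,Der_2(\Lambda E))=\{u\in Z^1(M,Der_2(\Lambda E)) : c_u\in B^2(M,Der_4(\Lambda E))\},$$ and for $v\in C^0(M,Der_2(\Lambda E))$ let $F(v,u)_{ij}=\tfrac12\big([v_i+v_j,u_{ij}]-[v_i,v_j]\big)$. A map $D:H^0(M,Aut(E))\times C^0(M,Der_2(\Lambda E))\times\tilde Z^1(M,Der_2(\Lambda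 E))\to C^1(M,Der_4(\Lambda E))$ is called strongly compatible if for all $(\varphi,v,u)$ $$d(D(\varphi,v,u))=c_u,\qquad \varphi.D(\varphi,v,u)=D(\mathrm{Id},0,\varphi.u+d(\varphi.v))+F(\varphi.v,\varphi.u),$$ $$\varphi.D(\varphi,v,u)-D(\mathrm{Id},0,\varphi.u)\in B^1(M,Der_4(\Lambda E)).$$ Suppose $H^0(M,Der_2(\Lambda E))=0$. Then: 1. A strongly compatible map $D$ exists. 2. Every cocycle in $Z^1(M,G_E)$ is $\exp(u_2+u_4)$ for unique $u_2\in C^1(M,Der_2(\Lambda E))$ and $u_4\in C^1(M,Der_4(\Lambda E))$. 3. For every strongly compatible $D$ there is a bijection $$\sigma_D:H^1(M,G_E)\to\big(\tilde Z^1(M,Der_2(\Lambda E))/B^1(M,Der_2(\Lambda E))\big)\oplus H^1(M,Der_4(\Lambda E))$$ such that, whenever $u_2\in C^1(M,Der_2(\Lambda E))$, $u_4\in C^1(M,Der_4(\Lambda E))$ and $\exp(u_2+u_4)\in Z^1(M,G_E)$, one has $u_2\in\tilde Z^1(M,Der_2(\Lambda E))$, $D(\mathrm{Id},0,u_2)+u_4\in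 Z^1(M,Der_4(\Lambda E))$ and $$\sigma_D([\exp(u_2+u_4)])=\big([u_2],[D(\mathrm{Id},0,u_2)+u_4]\big).$$ 4. If moreover $\varphi.D(\mathrm{Id},0,u)-D(\mathrm{Id},0,\varphi.u)\in B^1(M,Der_4(\Lambda E))$ for all $\varphi\in H^0(M,Aut(E))$ and $u\in\tilde Z^1(M,Der_2(\Lambda E))$, then $\sigma_D$ is $H^0(M,Aut(E))$-equivariant (for the diagonal action on the target). -/

import Mathlib

open scoped Manifold ContDiff
open TopologicalSpace Bundle

noncomputable section

namespace SplitSuper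

/-! ## The sheaf of holomorphic sections of the exterior algebra bundle

`M` is a complex manifold modelled on `EB`, and `E` is a holomorphic vector bundle over `M` with
typical fibre `F`. -/

theorem map_mem_exteriorPower {V W : Type*} [AddCommGroup V] [Module ℂ V] [AddCommGroup W]
    [Module ℂ W] (f : V →ₗ[ℂ] W) {j : ℕ} {a : ExteriorAlgebra ℂ V} (ha : a ∈ ⋀[ℂ]^j V) :
    ExteriorAlgebra.map f a ∈ ⋀[ℂ]^j W := by
  have h := Submodule.mem_map_of_mem (f := (ExteriorAlgebra.map f).toLinearMap) ha
  rw [Submodule.map_pow] at h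
  have h2 : (LinearMap.range (ExteriorAlgebra.ι ℂ : V →ₗ[ℂ] _)).map
      (ExteriorAlgebra.map f).toLinearMap ≤ LinearMap.range (ExteriorAlgebra.ι ℂ) := by
    rw [Submodule.map_le_iff_le_comap]
    rintro _ ⟨v, rfl⟩
    exact ⟨f v, (ExteriorAlgebra.map_apply_ι _ _).symm⟩
  exact SetLike.le_def.1 (pow_le_pow_left' h2 j) h

section Sheaf

variable (EB : Type*) [NormedAddCommGroup EB] [NormedSpace ℂ EB]
  {M : Type*} [TopologicalSpace M] [ChartedSpace EB M]
  (F : Type*) [NormedAddCommGroup F] [NormedSpace ℂ F]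
  (E : M → Type*) [∀ x, AddCommGroup (E x)] [∀ x, Module ℂ (E x)]
  [∀ x, TopologicalSpace (E x)] [TopologicalSpace (TotalSpace F E)] [FiberBundle F E]

/-- Arbitrary (not necessarily continuous) sections over `V` of the bundle of exterior algebras. -/
abbrev RoughSections (V : Opens M) : Type _ := ∀ x : V, ExteriorAlgebra ℂ (E x)

/-- Restriction of rough sections. -/
def roughRes {V W : Opens M} (h : W ≤ V) : RoughSections E V →ₐ[ℂ] RoughSections E W where
  toFun s x := s ⟨x.1, h x.2⟩
  map_one' := rfl
  map_mul' _ _ := rfl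
  map_zero' := rfl
  map_add' _ _ := rfl
  commutes' _ := rfl

/-- Holomorphic functions on `W`, as sections of the degree `0` part of the exterior algebra. -/
def holFunctions (W : Opens M) : Set (RoughSections E W) :=
  {a | ∃ f : W → ℂ, ContMDiff 𝓘(ℂ, EB) 𝓘(ℂ) ω f ∧ a = fun x => algebraMap ℂ _ (f x)}

/-- Holomorphic sections of `E` over `W`, as sections of the degree `1` part of the exterior
algebra. -/
def holSections (W : Opens M) : Set (RoughSections E W) :=
  {a | ∃ s : ∀ x : W, E x,
    ContMDiff 𝓘(ℂ, EB) (𝓘(ℂ, EB).prod 𝓘(ℂ, F)) ω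
      (fun x : W => (TotalSpace.mk' F (x : M) (s x) : TotalSpace F E)) ∧
    a = fun x => ExteriorAlgebra.ι ℂ (s x)}

/-- The algebra generated by holomorphic functions and holomorphic sections of `E` over `W`. -/
def polySections (W : Opens M) : Subalgebra ℂ (RoughSections E W) :=
  Algebra.adjoin ℂ (holFunctions EB E W ∪ holSections EB F E W)

theorem roughRes_polySections {V W : Opens M} (h : W ≤ V) {s : RoughSections E V}
    (hs : s ∈ polySections EB F E V) : roughRes E h s ∈ polySections EB F E W := by
  have : polySections EB F E V ≤ (polySections EB F E W).comap (roughRes E h) := by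
    refine Algebra.adjoin_le ?_
    rintro a (⟨f, hf, rfl⟩ | ⟨f, hf, rfl⟩)
    · exact Algebra.subset_adjoin (Or.inl ⟨fun x => f ⟨x.1, h x.2⟩,
        hf.comp (contMDiff_inclusion h), rfl⟩)
    · exact Algebra.subset_adjoin (Or.inr ⟨fun x => f ⟨x.1, h x.2⟩,
        hf.comp (contMDiff_inclusion h), rfl⟩)
  exact this hs

/-- `𝒪_{ΛE}(V)`: the algebra of holomorphic sections of `ΛE` over `V`, i.e. of those sections which
are locally polynomials in holomorphic functions and holomorphic sections of `E`. -/
def O (V : Opens M) : Subalgebra ℂ (RoughSections E V) where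
  carrier := {s | ∀ x : V, ∃ (W : Opens M) (h : W ≤ V), x.1 ∈ W ∧
    roughRes E h s ∈ polySections EB F E W}
  mul_mem' := by
    intro a b ha hb x
    obtain ⟨W, h, hx, hW⟩ := ha x
    obtain ⟨W', h', hx', hW'⟩ := hb x
    refine ⟨W ⊓ W', inf_le_left.trans h, ⟨hx, hx'⟩, ?_⟩
    rw [map_mul]
    exact mul_mem (roughRes_polySections EB F E inf_le_left hW)
      (roughRes_polySections EB F E inf_le_right hW')
  add_mem' := by
    intro a b ha hb x
    obtain ⟨W, h, hx, hW⟩ := ha x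
    obtain ⟨W', h', hx', hW'⟩ := hb x
    refine ⟨W ⊓ W', inf_le_left.trans h, ⟨hx, hx'⟩, ?_⟩
    rw [map_add]
    exact add_mem (roughRes_polySections EB F E inf_le_left hW)
      (roughRes_polySections EB F E inf_le_right hW')
  algebraMap_mem' r x := ⟨V, le_rfl, x.2, by
    rw [AlgHom.commutes]; exact algebraMap_mem _ r⟩

/-- The algebra `𝒪_{ΛE}(V)`, as a type. -/
def Sec (V : Opens M) : Type _ := O EB F E V

instance (V : Opens M) : Ring (Sec EB F E V) := inferInstanceAs (Ring (O EB F E V))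

instance (V : Opens M) : Algebra ℂ (Sec EB F E V) := inferInstanceAs (Algebra ℂ (O EB F E V))

/-- Restriction `𝒪_{ΛE}(V) → 𝒪_{ΛE}(W)`. -/
def res {V W : Opens M} (h : W ≤ V) : Sec EB F E V →ₐ[ℂ] Sec EB F E W :=
  ((roughRes E h).comp (O EB F E V).val).codRestrict (O EB F E W) (by
    rintro ⟨s, hs⟩ x
    obtain ⟨W', h', hx, hW'⟩ := hs ⟨x.1, h x.2⟩
    exact ⟨W' ⊓ W, inf_le_right, ⟨hx, x.2⟩,
      roughRes_polySections EB F E (inf_le_left : W' ⊓ W ≤ W') hW'⟩)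

/-- `𝒪_{Λ^j E}(V)` as a subspace of `𝒪_{ΛE}(V)`. -/
def gr (j : ℕ) (V : Opens M) : Submodule ℂ (Sec EB F E V) where
  carrier := {s | ∀ x : V, s.1 x ∈ ⋀[ℂ]^j (E x)}
  add_mem' ha hb x := add_mem (ha x) (hb x)
  zero_mem' x := zero_mem (⋀[ℂ]^j (E x))
  smul_mem' c _ ha x := Submodule.smul_mem _ c (ha x)

/-- The pointwise projection `ΛE → Λ^j E` on rough sections. -/
def roughProj (j : ℕ) (V : Opens M) : RoughSections E V →ₗ[ℂ] RoughSections E V where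
  toFun s x := (DirectSum.decompose (fun i : ℕ => ⋀[ℂ]^i (E x)) (s x) j : ExteriorAlgebra ℂ (E x))
  map_add' s t := by
    funext x
    simp [DirectSum.decompose_add]
  map_smul' c s := by
    funext x
    simp only [Pi.smul_apply, DirectSum.decompose_smul, RingHom.id_apply]
    rfl

theorem roughProj_polySections (j : ℕ) (W : Opens M) {s : RoughSections E W}
    (hs : s ∈ polySections EB F E W) : roughProj E j W s ∈ polySections EB F E W := by
  have hom : ∀ (d : ℕ) (a : RoughSections E W), a ∈ polySections EB F E W →
      (∀ x : W, a x ∈ ⋀[ℂ]^d (E x)) → ∀ j, roughProj E j W a ∈ polySections EB F E W := by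
    intro d a ha hd j
    by_cases hj : d = j
    · subst hj
      convert ha using 1
      funext x
      exact DirectSum.decompose_of_mem_same (fun i : ℕ => ⋀[ℂ]^i (E x)) (hd x)
    · convert zero_mem (polySections EB F E W) using 1
      funext x
      exact DirectSum.decompose_of_mem_ne (fun i : ℕ => ⋀[ℂ]^i (E x)) (hd x) hj
  revert j
  refine Algebra.adjoin_induction (p := fun s _ => ∀ j, roughProj E j W s ∈ polySections EB F E W)
    ?_ ?_ ?_ ?_ hs
  · rintro a ha
    have ha' : a ∈ polySections EB F E W := Algebra.subset_adjoin ha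
    rcases ha with ⟨f, hf, rfl⟩ | ⟨f, hf, rfl⟩
    · exact hom 0 _ ha' fun x => SetLike.algebraMap_mem_graded (fun i : ℕ => ⋀[ℂ]^i (E x)) (f x)
    · refine hom 1 _ ha' fun x => ?_
      change _ ∈ (LinearMap.range (ExteriorAlgebra.ι ℂ : E x →ₗ[ℂ] _)) ^ 1
      rw [pow_one]
      exact LinearMap.mem_range_self _ _
  · intro r
    exact hom 0 _ (algebraMap_mem _ r) fun x =>
      SetLike.algebraMap_mem_graded (fun i : ℕ => ⋀[ℂ]^i (E x)) r
  · intro a b _ _ ha hb j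
    rw [map_add]
    exact add_mem (ha j) (hb j)
  · intro a b _ _ ha hb j
    have : roughProj E j W (a * b) =
        ∑ p ∈ Finset.HasAntidiagonal.antidiagonal j, roughProj E p.1 W a * roughProj E p.2 W b := by
      funext x
      rw [Finset.sum_apply]
      change ((DirectSum.decompose (fun i : ℕ => ⋀[ℂ]^i (E x)) (a x * b x) j :
        ⋀[ℂ]^j (E x)) : ExteriorAlgebra ℂ (E x)) = _
      rw [DirectSum.decompose_mul, DirectSum.coe_mul_apply_eq_sum_antidiagonal]
      rfl
    rw [this]
    exact sum_mem fun p _ => mul_mem (ha p.1) (hb p.2)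

/-- The projection `𝒪_{ΛE}(V) → 𝒪_{Λ^j E}(V) ⊆ 𝒪_{ΛE}(V)`. -/
def proj (j : ℕ) (V : Opens M) : Module.End ℂ (Sec EB F E V) :=
  ((roughProj E j V).comp (O EB F E V).val.toLinearMap).codRestrict
    (Subalgebra.toSubmodule (O EB F E V)) (by
      rintro ⟨s, hs⟩ x
      obtain ⟨W, h, hx, hW⟩ := hs x
      exact ⟨W, h, hx, roughProj_polySections EB F E j W hW⟩)

/-! ## The sheaf of `ℂ`-linear endomorphisms of `𝒪_{ΛE}` and its subsheaves -/

/-- Families of endomorphisms of all `𝒪_{ΛE}(W)`, `W ⊆ U` open. -/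
def RawEnd (U : Opens M) : Type _ := ∀ W : {W : Opens M // W ≤ U}, Module.End ℂ (Sec EB F E W.1)

instance (U : Opens M) : Ring (RawEnd EB F E U) :=
  inferInstanceAs (Ring (∀ W : {W : Opens M // W ≤ U}, Module.End ℂ (Sec EB F E W.1)))

instance (U : Opens M) : Algebra ℂ (RawEnd EB F E U) :=
  inferInstanceAs (Algebra ℂ (∀ W : {W : Opens M // W ≤ U}, Module.End ℂ (Sec EB F E W.1)))

/-- Sections over `U` of the sheaf of `ℂ`-linear endomorphisms of the sheaf `𝒪_{ΛE}`: families of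
endomorphisms of all `𝒪_{ΛE}(W)`, `W ⊆ U` open, which commute with restrictions. -/
def endo (U : Opens M) : Subalgebra ℂ (RawEnd EB F E U) where
  carrier := {f | ∀ (W W' : {W : Opens M // W ≤ U}) (h : W'.1 ≤ W.1) (s : Sec EB F E W.1),
    res EB F E h (f W s) = f W' (res EB F E h s)}
  mul_mem' := by
    intro f g hf hg W W' h s
    change res EB F E h (f W (g W s)) = f W' (g W' (res EB F E h s))
    rw [hf W W' h, hg W W' h]
  add_mem' := by
    intro f g hf hg W W' h s
    change res EB F E h (f W s + g W s) = f W' (res EB F E h s) + g W' (res EB F E h s)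
    rw [map_add, hf W W' h, hg W W' h]
  algebraMap_mem' := by
    intro r W W' h s
    change res EB F E h (r • s) = r • res EB F E h s
    rw [map_smul]

/-- The algebra `endo EB F E U`, as a type. -/
def ShEnd (U : Opens M) : Type _ := endo EB F E U

instance (U : Opens M) : Ring (ShEnd EB F E U) := inferInstanceAs (Ring (endo EB F E U))

instance (U : Opens M) : Algebra ℂ (ShEnd EB F E U) :=
  inferInstanceAs (Algebra ℂ (endo EB F E U))

variable {EB F E} in
/-- The component of a sheaf endomorphism on an open set `W ⊆ U`. -/
def ShEnd.app {U : Opens M} (f : ShEnd EB F E U) (W : Opens M) (hW : W ≤ U) :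
    Module.End ℂ (Sec EB F E W) := Subtype.val f ⟨W, hW⟩

variable {EB F E} in
theorem ShEnd.ext {U : Opens M} {f g : ShEnd EB F E U}
    (h : ∀ W hW s, f.app W hW s = g.app W hW s) : f = g :=
  Subtype.ext (funext fun W => LinearMap.ext fun s => h W.1 W.2 s)

/-- Restriction of sheaf endomorphisms. -/
def resEnd {U U' : Opens M} (h : U' ≤ U) : ShEnd EB F E U →ₐ[ℂ] ShEnd EB F E U' where
  toFun f := ⟨fun W => f.app W.1 (W.2.trans h),
    fun W W' hW s => f.2 ⟨W.1, W.2.trans h⟩ ⟨W'.1, W'.2.trans h⟩ hW s⟩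
  map_one' := rfl
  map_mul' _ _ := rfl
  map_zero' := rfl
  map_add' _ _ := rfl
  commutes' _ := rfl

/-- The projection onto `𝒪_{Λ^j E}` as a global endomorphism of the sheaf `𝒪_{ΛE}`. -/
def projEnd (j : ℕ) : ShEnd EB F E (⊤ : Opens M) :=
  ⟨fun W => proj EB F E j W.1, fun _ _ _ _ => rfl⟩

/-- `Der_k(ΛE)(U)`: derivations `w` of the sheaf of algebras `𝒪_{ΛE}|_U` with
`w(𝒪_{Λ^j E}) ⊆ 𝒪_{Λ^{j+k} E}` for all `j`. (Only even `k` are used; such derivations are even, so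
that no signs occur in the Leibniz rule.) -/
def Der (k : ℕ) (U : Opens M) : Submodule ℂ (ShEnd EB F E U) where
  carrier := {f | ∀ (W : Opens M) (hW : W ≤ U),
    (∀ s t, f.app W hW (s * t) = f.app W hW s * t + s * f.app W hW t) ∧
    ∀ j, ∀ s ∈ gr EB F E j W, f.app W hW s ∈ gr EB F E (j + k) W}
  add_mem' := by
    intro f g hf hg W hW
    refine ⟨fun s t => ?_, fun j s hs => add_mem ((hf W hW).2 j s hs) ((hg W hW).2 j s hs)⟩
    change f.app W hW (s * t) + g.app W hW (s * t) =
      (f.app W hW s + g.app W hW s) * t + s * (f.app W hW t + g.app W hW t)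
    rw [(hf W hW).1, (hg W hW).1, add_mul, mul_add]
    abel
  zero_mem' := by
    intro W hW
    refine ⟨fun s t => ?_, fun j s _ => zero_mem (gr EB F E (j + k) W)⟩
    change (0 : Sec EB F E W) = 0 * t + s * 0
    rw [zero_mul, mul_zero, add_zero]
  smul_mem' := by
    intro c f hf W hW
    refine ⟨fun s t => ?_, fun j s hs => Submodule.smul_mem _ c ((hf W hW).2 j s hs)⟩
    change c • f.app W hW (s * t) = (c • f.app W hW s) * t + s * (c • f.app W hW t)
    rw [(hf W hW).1, smul_add, smul_mul_assoc, mul_smul_comm]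

/-- `G_E(U)`: automorphisms `f` of the sheaf of algebras `𝒪_{ΛE}|_U` which preserve the
`ℤ/2ℤ`-grading and satisfy `(f - Id)(𝒪_{Λ^j E}) ⊆ ⨁_{k ≥ 1} 𝒪_{Λ^{j+2k} E}` for all `j`. -/
def GE (U : Opens M) : Set (ShEnd EB F E U) :=
  {f | IsUnit f ∧ ∀ (W : Opens M) (hW : W ≤ U),
    f.app W hW 1 = 1 ∧ (∀ s t, f.app W hW (s * t) = f.app W hW s * f.app W hW t) ∧
    (∀ s ∈ ⨆ i : ℕ, gr EB F E (2 * i) W, f.app W hW s ∈ ⨆ i : ℕ, gr EB F E (2 * i) W) ∧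
    (∀ s ∈ ⨆ i : ℕ, gr EB F E (2 * i + 1) W, f.app W hW s ∈ ⨆ i : ℕ, gr EB F E (2 * i + 1) W) ∧
    ∀ j, ∀ s ∈ gr EB F E j W, f.app W hW s - s ∈ ⨆ k : ℕ, gr EB F E (j + 2 * (k + 1)) W}

theorem resEnd_Der (k : ℕ) {U U' : Opens M} (h : U' ≤ U) {f : ShEnd EB F E U}
    (hf : f ∈ Der EB F E k U) : resEnd EB F E h f ∈ Der EB F E k U' :=
  fun W hW => hf W (hW.trans h)

/-! ## Global automorphisms of `E` -/

/-- `H⁰(M, Aut(E))`: holomorphic vector bundle automorphisms of `E` over the identity of `M`. -/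
def AutE : Subgroup (∀ x : M, E x ≃ₗ[ℂ] E x) where
  carrier := {φ |
    ContMDiff (𝓘(ℂ, EB).prod 𝓘(ℂ, F)) (𝓘(ℂ, EB).prod 𝓘(ℂ, F)) ω
      (fun p : TotalSpace F E => (TotalSpace.mk' F p.1 (φ p.1 p.2) : TotalSpace F E)) ∧
    ContMDiff (𝓘(ℂ, EB).prod 𝓘(ℂ, F)) (𝓘(ℂ, EB).prod 𝓘(ℂ, F)) ω
      (fun p : TotalSpace F E => (TotalSpace.mk' F p.1 ((φ⁻¹) p.1 p.2) : TotalSpace F E))}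
  mul_mem' := by
    rintro φ ψ ⟨h1, h2⟩ ⟨h3, h4⟩
    refine ⟨h1.comp h3, ?_⟩
    rw [mul_inv_rev]
    exact h4.comp h2
  one_mem' := by
    rw [Set.mem_ofPred_eq, inv_one, and_self]
    exact contMDiff_id
  inv_mem' := by
    rintro φ ⟨h1, h2⟩
    exact ⟨h2, by rwa [inv_inv]⟩

variable {EB F E}

/-- The action of a bundle automorphism on rough sections of `ΛE`. -/
def roughLam (φ : AutE EB F E) (V : Opens M) : RoughSections E V →ₐ[ℂ] RoughSections E V where
  toFun s x := ExteriorAlgebra.map (φ.1 x.1 : E x.1 →ₗ[ℂ] E x.1) (s x)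
  map_one' := funext fun _ => map_one _
  map_mul' _ _ := funext fun _ => map_mul _ _ _
  map_zero' := funext fun _ => map_zero _
  map_add' _ _ := funext fun _ => map_add _ _ _
  commutes' r := funext fun _ => AlgHom.commutes _ r

theorem roughLam_polySections (φ : AutE EB F E) (W : Opens M) {s : RoughSections E W}
    (hs : s ∈ polySections EB F E W) : roughLam φ W s ∈ polySections EB F E W := by
  have : polySections EB F E W ≤ (polySections EB F E W).comap (roughLam φ W) := by
    refine Algebra.adjoin_le ?_
    rintro a (⟨f, hf, rfl⟩ | ⟨f, hf, rfl⟩)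
    · exact Algebra.subset_adjoin (Or.inl ⟨f, hf, funext fun x => AlgHom.commutes _ _⟩)
    · exact Algebra.subset_adjoin (Or.inr ⟨fun x => φ.1 x.1 (f x), φ.2.1.comp hf,
        funext fun x => ExteriorAlgebra.map_apply_ι _ _⟩)
  exact this hs

/-- The action of a bundle automorphism on `𝒪_{ΛE}(V)`. -/
def lam (φ : AutE EB F E) (V : Opens M) : Sec EB F E V →ₐ[ℂ] Sec EB F E V :=
  ((roughLam φ V).comp (O EB F E V).val).codRestrict (O EB F E V) (by
    rintro ⟨s, hs⟩ x
    obtain ⟨W, h, hx, hW⟩ := hs x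
    exact ⟨W, h, hx, roughLam_polySections φ W hW⟩)

/-- The global automorphism `Λφ` of the sheaf `𝒪_{ΛE}` induced by `φ ∈ H⁰(M, Aut(E))`. -/
def lamEnd (φ : AutE EB F E) : ShEnd EB F E (⊤ : Opens M) :=
  ⟨fun W => (lam φ W.1).toLinearMap, fun _ _ _ _ => rfl⟩

theorem lamEnd_one : lamEnd (1 : AutE EB F E) = 1 := by
  refine ShEnd.ext fun W _ s => Subtype.ext (funext fun x => ?_)
  change ExteriorAlgebra.map (LinearMap.id : E x.1 →ₗ[ℂ] E x.1) (s.1 x) = s.1 x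
  rw [ExteriorAlgebra.map_id]
  rfl

theorem lamEnd_mul (φ ψ : AutE EB F E) : lamEnd (φ * ψ) = lamEnd φ * lamEnd ψ := by
  refine ShEnd.ext fun W _ s => Subtype.ext (funext fun x => ?_)
  change ExteriorAlgebra.map ((φ.1 x.1 : E x.1 →ₗ[ℂ] E x.1) ∘ₗ (ψ.1 x.1 : E x.1 →ₗ[ℂ] E x.1))
    (s.1 x) = ExteriorAlgebra.map (φ.1 x.1 : E x.1 →ₗ[ℂ] E x.1)
      (ExteriorAlgebra.map (ψ.1 x.1 : E x.1 →ₗ[ℂ] E x.1) (s.1 x))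
  rw [← ExteriorAlgebra.map_comp_map]
  rfl

theorem lamEnd_mul_inv (φ : AutE EB F E) : lamEnd φ * lamEnd φ⁻¹ = 1 := by
  rw [← lamEnd_mul, mul_inv_cancel, lamEnd_one]

theorem lamEnd_inv_mul (φ : AutE EB F E) : lamEnd φ⁻¹ * lamEnd φ = 1 := by
  rw [← lamEnd_mul, inv_mul_cancel, lamEnd_one]

theorem lam_gr (φ : AutE EB F E) (j : ℕ) (V : Opens M) {s : Sec EB F E V}
    (hs : s ∈ gr EB F E j V) : lam φ V s ∈ gr EB F E j V :=
  fun x => map_mem_exteriorPower _ (hs x)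

theorem lam_proj (φ : AutE EB F E) (j : ℕ) (V : Opens M) (s : Sec EB F E V) :
    lam φ V (proj EB F E j V s) = proj EB F E j V (lam φ V s) := by
  refine Subtype.ext (funext fun x => ?_)
  have key : ∀ a : ExteriorAlgebra ℂ (E x.1),
      ExteriorAlgebra.map (φ.1 x.1 : E x.1 →ₗ[ℂ] E x.1)
        (DirectSum.decompose (fun i : ℕ => ⋀[ℂ]^i (E x.1)) a j : ExteriorAlgebra ℂ (E x.1)) =
      (DirectSum.decompose (fun i : ℕ => ⋀[ℂ]^i (E x.1))
        (ExteriorAlgebra.map (φ.1 x.1 : E x.1 →ₗ[ℂ] E x.1) a) j : ExteriorAlgebra ℂ (E x.1)) := by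
    intro a
    refine DirectSum.Decomposition.inductionOn (fun i : ℕ => ⋀[ℂ]^i (E x.1)) ?_ ?_ ?_ a
    · simp
    · intro i m
      have hm := map_mem_exteriorPower (φ.1 x.1 : E x.1 →ₗ[ℂ] E x.1) m.2
      by_cases hij : i = j
      · subst hij
        rw [DirectSum.decompose_of_mem_same (fun i : ℕ => ⋀[ℂ]^i (E x.1)) m.2,
          DirectSum.decompose_of_mem_same (fun i : ℕ => ⋀[ℂ]^i (E x.1)) hm]
      · rw [DirectSum.decompose_of_mem_ne (fun i : ℕ => ⋀[ℂ]^i (E x.1)) m.2 hij,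
          DirectSum.decompose_of_mem_ne (fun i : ℕ => ⋀[ℂ]^i (E x.1)) hm hij, map_zero]
    · intro a b ha hb
      simp only [DirectSum.decompose_add, DirectSum.add_apply, Submodule.coe_add, map_add, ha, hb]
  exact key (s.1 x)

theorem lam_lam_inv (φ : AutE EB F E) (V : Opens M) (s : Sec EB F E V) :
    lam φ V (lam φ⁻¹ V s) = s :=
  LinearMap.congr_fun (congrArg (fun f => ShEnd.app f V le_top) (lamEnd_mul_inv φ)) s

/-- Conjugation `f ↦ Λφ ∘ f ∘ Λφ⁻¹` of local endomorphisms of `𝒪_{ΛE}`. -/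
def conjEnd (φ : AutE EB F E) (U : Opens M) (f : ShEnd EB F E U) : ShEnd EB F E U :=
  resEnd EB F E le_top (lamEnd φ) * f * resEnd EB F E le_top (lamEnd φ⁻¹)

theorem conjEnd_app (φ : AutE EB F E) (U : Opens M) (f : ShEnd EB F E U) (W : Opens M)
    (hW : W ≤ U) (s : Sec EB F E W) :
    (conjEnd φ U f).app W hW s = lam φ W (f.app W hW (lam φ⁻¹ W s)) := rfl

theorem conjEnd_Der (φ : AutE EB F E) {k : ℕ} {U : Opens M} {f : ShEnd EB F E U}
    (hf : f ∈ Der EB F E k U) : conjEnd φ U f ∈ Der EB F E k U := by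
  intro W hW
  refine ⟨fun s t => ?_, fun j s hs => ?_⟩
  · simp only [conjEnd_app]
    rw [map_mul, (hf W hW).1, map_add, map_mul, map_mul, lam_lam_inv, lam_lam_inv]
  · rw [conjEnd_app]
    exact lam_gr φ _ _ ((hf W hW).2 j _ (lam_gr φ⁻¹ _ _ hs))

theorem lam_iSup_gr (φ : AutE EB F E) (V : Opens M) (d : ℕ → ℕ) {s : Sec EB F E V}
    (hs : s ∈ ⨆ i : ℕ, gr EB F E (d i) V) : lam φ V s ∈ ⨆ i : ℕ, gr EB F E (d i) V := by
  have h : (⨆ i : ℕ, gr EB F E (d i) V) ≤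
      (⨆ i : ℕ, gr EB F E (d i) V).comap (lam φ V).toLinearMap :=
    iSup_le fun i _ ht => (le_iSup (fun i => gr EB F E (d i) V) i) (lam_gr φ (d i) V ht)
  exact h hs

theorem isUnit_lamEnd (φ : AutE EB F E) : IsUnit (lamEnd φ) :=
  ⟨⟨lamEnd φ, lamEnd φ⁻¹, lamEnd_mul_inv φ, lamEnd_inv_mul φ⟩, rfl⟩

theorem conjEnd_GE (φ : AutE EB F E) {U : Opens M} {f : ShEnd EB F E U}
    (hf : f ∈ GE EB F E U) : conjEnd φ U f ∈ GE EB F E U := by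
  refine ⟨(((isUnit_lamEnd φ).map (resEnd EB F E le_top)).mul hf.1).mul
    ((isUnit_lamEnd φ⁻¹).map (resEnd EB F E le_top)), fun W hW => ?_⟩
  obtain ⟨h1, hm, he, ho, hd⟩ := hf.2 W hW
  simp only [conjEnd_app]
  refine ⟨?_, fun s t => ?_, fun s hs => ?_, fun s hs => ?_, fun j s hs => ?_⟩
  · rw [map_one, h1, map_one]
  · rw [map_mul, hm, map_mul]
  · exact lam_iSup_gr φ _ _ (he _ (lam_iSup_gr φ⁻¹ _ _ hs))
  · exact lam_iSup_gr φ _ _ (ho _ (lam_iSup_gr φ⁻¹ _ _ hs))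
  · have h := lam_iSup_gr φ _ _ (hd j _ (lam_gr φ⁻¹ _ _ hs))
    rw [map_sub, lam_lam_inv] at h
    exact h

end Sheaf

/-! ## Čech cochains

Cochains are taken with respect to a downward directed family of open covers with a common index
set. A single open cover is such a family, and so is the family of all open covers `(U_x)` indexed
by the points of `M` with `x ∈ U_x`; for the latter one obtains the Čech cohomology of `M` itself,
because every open cover is refined by a cover of this kind. -/

/-- A family of open covers of `M`, all indexed by `ι`, which is itself indexed by `J`; a larger
index in `J` means a finer cover. -/
structure CoverSystem (M : Type*) [TopologicalSpace M] (J ι : Type*) [Preorder J] where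
  cover : J → ι → Opens M
  anti : ∀ {i j : J}, i ≤ j → ∀ a, cover j a ≤ cover i a
  covers : ∀ j, ⨆ a, cover j a = ⊤

namespace CoverSystem

/-- A single open cover. -/
def single {M : Type*} [TopologicalSpace M] {ι : Type*} (U : ι → Opens M) (hU : ⨆ a, U a = ⊤) :
    CoverSystem M Unit ι where
  cover _ := U
  anti _ _ := le_rfl
  covers _ := hU

/-- Open covers indexed by the points of `M`. -/
abbrev PointedCover (M : Type*) [TopologicalSpace M] : Type _ :=
  {U : M → (Opens M)ᵒᵈ // ∀ x, x ∈ OrderDual.ofDual (U x)}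

instance (M : Type*) [TopologicalSpace M] : Nonempty (PointedCover M) :=
  ⟨⟨fun _ => OrderDual.toDual ⊤, fun _ => trivial⟩⟩

instance (M : Type*) [TopologicalSpace M] : IsDirectedOrder (PointedCover M) :=
  ⟨fun U V => ⟨⟨U.1 ⊔ V.1, fun x => ⟨U.2 x, V.2 x⟩⟩,
    (le_sup_left : U.1 ≤ U.1 ⊔ V.1), (le_sup_right : V.1 ≤ U.1 ⊔ V.1)⟩⟩

/-- The family of all open covers indexed by the points of `M`. -/
def pointed (M : Type*) [TopologicalSpace M] : CoverSystem M (PointedCover M) M where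
  cover U x := OrderDual.ofDual (U.1 x)
  anti h a := h a
  covers U := by
    rw [eq_top_iff]
    exact fun x _ => Opens.mem_iSup.2 ⟨x, U.2 x⟩

variable {M : Type*} [TopologicalSpace M] {J ι : Type*} [Preorder J]

/-- The intersection `U_{s 0} ∩ … ∩ U_{s q}` in the `j`-th cover. -/
def inter (𝔘 : CoverSystem M J ι) (j : J) {q : ℕ} (s : Fin (q + 1) → ι) : Opens M :=
  ⨅ k, 𝔘.cover j (s k)

theorem inter_anti (𝔘 : CoverSystem M J ι) {i j : J} (h : i ≤ j) {q : ℕ} (s : Fin (q + 1) → ι) :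
    𝔘.inter j s ≤ 𝔘.inter i s :=
  iInf_mono fun k => 𝔘.anti h (s k)

theorem inter_comp (𝔘 : CoverSystem M J ι) (j : J) {p q : ℕ} (a : Fin (q + 1) → Fin (p + 1))
    (s : Fin (p + 1) → ι) : 𝔘.inter j s ≤ 𝔘.inter j (s ∘ a) :=
  le_iInf fun k => iInf_le _ (a k)

end CoverSystem

section Cochains

variable (EB : Type*) [NormedAddCommGroup EB] [NormedSpace ℂ EB]
  {M : Type*} [TopologicalSpace M] [ChartedSpace EB M]
  (F : Type*) [NormedAddCommGroup F] [NormedSpace ℂ F]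
  (E : M → Type*) [∀ x, AddCommGroup (E x)] [∀ x, Module ℂ (E x)]
  [∀ x, TopologicalSpace (E x)] [TopologicalSpace (TotalSpace F E)] [FiberBundle F E]
  {J ι : Type*} [Preorder J] [IsDirectedOrder J] [Nonempty J] (𝔘 : CoverSystem M J ι)

/-- `q`-cochains of the `j`-th cover with values in the sheaf of endomorphisms of `𝒪_{ΛE}`. -/
abbrev CoverCochain (q : ℕ) (j : J) : Type _ :=
  ∀ s : Fin (q + 1) → ι, ShEnd EB F E (𝔘.inter j s)

/-- Passage to a finer cover. -/
def refine (q : ℕ) (i j : J) (h : i ≤ j) :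
    CoverCochain EB F E 𝔘 q i →ₐ[ℂ] CoverCochain EB F E 𝔘 q j where
  toFun f s := resEnd EB F E (𝔘.inter_anti h s) (f s)
  map_one' := rfl
  map_mul' _ _ := rfl
  map_zero' := rfl
  map_add' _ _ := rfl
  commutes' _ := rfl

instance (q : ℕ) :
    DirectedSystem (CoverCochain EB F E 𝔘 q) (refine EB F E 𝔘 q · · ·) where
  map_self _ _ := rfl
  map_map _ _ _ _ _ _ := rfl

/-- The algebra `C^q(M, End(ΛE))` of Čech `q`-cochains with values in the sheaf of `ℂ`-linear
endomorphisms of `𝒪_{ΛE}`: the direct limit over the covers of the family. All other cochains are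
elements of this algebra. -/
def Cochain (q : ℕ) : Type _ :=
  DirectLimit (CoverCochain EB F E 𝔘 q) (refine EB F E 𝔘 q)

instance (q : ℕ) : Ring (Cochain EB F E 𝔘 q) :=
  inferInstanceAs (Ring (DirectLimit (CoverCochain EB F E 𝔘 q) (refine EB F E 𝔘 q)))

instance (q : ℕ) : Algebra ℂ (Cochain EB F E 𝔘 q) :=
  inferInstanceAs (Algebra ℂ (DirectLimit (CoverCochain EB F E 𝔘 q) (refine EB F E 𝔘 q)))

/-- The cochain in the direct limit defined by a cochain of the `j`-th cover. -/
def ofCover (q : ℕ) (j : J) : CoverCochain EB F E 𝔘 q j →ₐ[ℂ] Cochain EB F E 𝔘 q where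
  toFun f := (⟦⟨j, f⟩⟧ : DirectLimit (CoverCochain EB F E 𝔘 q) (refine EB F E 𝔘 q))
  map_one' := (DirectLimit.one_def j).symm
  map_mul' _ _ := (DirectLimit.mul_def _ _ _).symm
  map_zero' := (DirectLimit.zero_def j).symm
  map_add' _ _ := (DirectLimit.add_def _ _ _).symm
  commutes' r := (DirectLimit.map₀_algebraMap j r).symm

theorem ofCover_refine (q : ℕ) {i j : J} (h : i ≤ j) (f : CoverCochain EB F E 𝔘 q i) :
    ofCover EB F E 𝔘 q j (refine EB F E 𝔘 q i j h f) = ofCover EB F E 𝔘 q i f :=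
  Quotient.sound ⟨j, le_rfl, h, rfl⟩

theorem exists_ofCover {q : ℕ} (x : Cochain EB F E 𝔘 q) : ∃ j f, ofCover EB F E 𝔘 q j f = x := by
  obtain ⟨j, f, h⟩ := DirectLimit.exists_eq_mk _ x
  exact ⟨j, f, h.symm⟩

theorem exists_ofCover₂ {q : ℕ} (x y : Cochain EB F E 𝔘 q) :
    ∃ j f g, ofCover EB F E 𝔘 q j f = x ∧ ofCover EB F E 𝔘 q j g = y := by
  obtain ⟨j, f, g, h, h'⟩ := DirectLimit.exists_eq_mk₂ _ x y
  exact ⟨j, f, g, h.symm, h'.symm⟩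

/-- For a cochain `f` of the `j`-th cover, the cochain `(f_{s(a 0) … s(a q)})_s`. -/
def coverPull {p q : ℕ} (a : Fin (q + 1) → Fin (p + 1)) (j : J) :
    CoverCochain EB F E 𝔘 q j →ₐ[ℂ] CoverCochain EB F E 𝔘 p j where
  toFun f s := resEnd EB F E (𝔘.inter_comp j a s) (f (s ∘ a))
  map_one' := rfl
  map_mul' _ _ := rfl
  map_zero' := rfl
  map_add' _ _ := rfl
  commutes' _ := rfl

/-- The map underlying `pull`. -/
def pullFun {p q : ℕ} (a : Fin (q + 1) → Fin (p + 1)) :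
    Cochain EB F E 𝔘 q → Cochain EB F E 𝔘 p :=
  DirectLimit.map _ _ (fun j f => coverPull EB F E 𝔘 a j f) (fun _ _ _ _ => rfl)

theorem pullFun_ofCover {p q : ℕ} (a : Fin (q + 1) → Fin (p + 1)) (j : J)
    (f : CoverCochain EB F E 𝔘 q j) :
    pullFun EB F E 𝔘 a (ofCover EB F E 𝔘 q j f) =
      ofCover EB F E 𝔘 p j (coverPull EB F E 𝔘 a j f) := rfl

/-- The cochain `(x_{s(a 0) … s(a q)})_s`. For example, for a 1-cochain `u`, the 2-cochain
`(u_{jk})_{ijk}` is `pull ![1, 2] u`. -/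
def pull {p q : ℕ} (a : Fin (q + 1) → Fin (p + 1)) :
    Cochain EB F E 𝔘 q →ₐ[ℂ] Cochain EB F E 𝔘 p where
  toFun := pullFun EB F E 𝔘 a
  map_one' := by
    rw [← map_one (ofCover EB F E 𝔘 q (Classical.arbitrary J)), pullFun_ofCover, map_one, map_one]
  map_mul' x y := by
    obtain ⟨j, f, g, rfl, rfl⟩ := exists_ofCover₂ EB F E 𝔘 x y
    rw [← map_mul, pullFun_ofCover, pullFun_ofCover, pullFun_ofCover, map_mul, map_mul]
  map_zero' := by
    rw [← map_zero (ofCover EB F E 𝔘 q (Classical.arbitrary J)), pullFun_ofCover, map_zero,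
      map_zero]
  map_add' x y := by
    obtain ⟨j, f, g, rfl, rfl⟩ := exists_ofCover₂ EB F E 𝔘 x y
    rw [← map_add, pullFun_ofCover, pullFun_ofCover, pullFun_ofCover, map_add, map_add]
  commutes' r := by
    rw [← (ofCover EB F E 𝔘 q (Classical.arbitrary J)).commutes, pullFun_ofCover,
      AlgHom.commutes, AlgHom.commutes]

theorem pull_ofCover {p q : ℕ} (a : Fin (q + 1) → Fin (p + 1)) (j : J)
    (f : CoverCochain EB F E 𝔘 q j) :
    pull EB F E 𝔘 a (ofCover EB F E 𝔘 q j f) =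
      ofCover EB F E 𝔘 p j (coverPull EB F E 𝔘 a j f) := rfl

/-- The cochain of the `j`-th cover with all components equal to a global endomorphism. -/
def coverConst (q : ℕ) (j : J) : ShEnd EB F E (⊤ : Opens M) →ₐ[ℂ] CoverCochain EB F E 𝔘 q j where
  toFun f _ := resEnd EB F E le_top f
  map_one' := rfl
  map_mul' _ _ := rfl
  map_zero' := rfl
  map_add' _ _ := rfl
  commutes' _ := rfl

/-- The cochain with all components equal to a global endomorphism. -/
def const (q : ℕ) : ShEnd EB F E (⊤ : Opens M) →ₐ[ℂ] Cochain EB F E 𝔘 q :=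
  (ofCover EB F E 𝔘 q (Classical.arbitrary J)).comp
    (coverConst EB F E 𝔘 q (Classical.arbitrary J))

theorem const_eq (q : ℕ) (f : ShEnd EB F E (⊤ : Opens M)) (j : J) :
    const EB F E 𝔘 q f = ofCover EB F E 𝔘 q j (coverConst EB F E 𝔘 q j f) := by
  obtain ⟨k, h1, h2⟩ := exists_ge_ge (Classical.arbitrary J) j
  have e1 := ofCover_refine EB F E 𝔘 q h1 (coverConst EB F E 𝔘 q (Classical.arbitrary J) f)
  have e2 := ofCover_refine EB F E 𝔘 q h2 (coverConst EB F E 𝔘 q j f)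
  exact e1.symm.trans e2

/-- `C^q(M, Der_k(ΛE))`. -/
def derCochain (q k : ℕ) : Submodule ℂ (Cochain EB F E 𝔘 q) where
  carrier := {x | ∃ (j : J) (f : CoverCochain EB F E 𝔘 q j),
    (∀ s, f s ∈ Der EB F E k (𝔘.inter j s)) ∧ x = ofCover EB F E 𝔘 q j f}
  add_mem' := by
    rintro _ _ ⟨i, f, hf, rfl⟩ ⟨j, g, hg, rfl⟩
    obtain ⟨l, h1, h2⟩ := exists_ge_ge i j
    refine ⟨l, refine EB F E 𝔘 q i l h1 f + refine EB F E 𝔘 q j l h2 g, fun s =>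
      add_mem (resEnd_Der EB F E k (𝔘.inter_anti h1 s) (hf s))
        (resEnd_Der EB F E k (𝔘.inter_anti h2 s) (hg s)), ?_⟩
    rw [map_add, ofCover_refine, ofCover_refine]
  zero_mem' := ⟨Classical.arbitrary J, 0, fun _ => zero_mem _, (map_zero _).symm⟩
  smul_mem' := by
    rintro c _ ⟨j, f, hf, rfl⟩
    exact ⟨j, c • f, fun s => Submodule.smul_mem _ c (hf s), (map_smul _ c f).symm⟩

/-- `C^q(M, G_E)`. -/
def geCochain (q : ℕ) : Set (Cochain EB F E 𝔘 q) :=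
  {x | ∃ (j : J) (f : CoverCochain EB F E 𝔘 q j),
    (∀ s, f s ∈ GE EB F E (𝔘.inter j s)) ∧ x = ofCover EB F E 𝔘 q j f}

/-! ### The abelian complex -/

/-- `(dv)_{ij} = v_i - v_j`. -/
def d0 : Cochain EB F E 𝔘 0 →ₗ[ℂ] Cochain EB F E 𝔘 1 :=
  (pull EB F E 𝔘 ![0]).toLinearMap - (pull EB F E 𝔘 ![1]).toLinearMap

/-- `(du)_{ijk} = u_{ij} + u_{jk} - u_{ik}`. -/
def d1 : Cochain EB F E 𝔘 1 →ₗ[ℂ] Cochain EB F E 𝔘 2 :=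
  (pull EB F E 𝔘 ![0, 1]).toLinearMap + (pull EB F E 𝔘 ![1, 2]).toLinearMap
    - (pull EB F E 𝔘 ![0, 2]).toLinearMap

/-- `Z¹(M, Der_k(ΛE))`. -/
def Z1 (k : ℕ) : Submodule ℂ (Cochain EB F E 𝔘 1) :=
  derCochain EB F E 𝔘 1 k ⊓ LinearMap.ker (d1 EB F E 𝔘)

/-- `B¹(M, Der_k(ΛE))`. -/
def B1 (k : ℕ) : Submodule ℂ (Cochain EB F E 𝔘 1) :=
  (derCochain EB F E 𝔘 0 k).map (d0 EB F E 𝔘)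

/-- `B²(M, Der_k(ΛE))`. -/
def B2 (k : ℕ) : Submodule ℂ (Cochain EB F E 𝔘 2) :=
  (derCochain EB F E 𝔘 1 k).map (d1 EB F E 𝔘)

/-- `H¹(M, Der_k(ΛE))`. -/
abbrev H1Der (k : ℕ) : Type _ := Z1 EB F E 𝔘 k ⧸ (B1 EB F E 𝔘 k).submoduleOf (Z1 EB F E 𝔘 k)

/-! ### The non-abelian complex -/

/-- `Z¹(M, G_E)`: cochains `g` with values in `G_E` such that `g_{ij} g_{jk} = g_{ik}`. -/
def Z1G : Set (Cochain EB F E 𝔘 1) :=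
  {g | g ∈ geCochain EB F E 𝔘 1 ∧
    pull EB F E 𝔘 (p := 2) ![0, 1] g * pull EB F E 𝔘 ![1, 2] g = pull EB F E 𝔘 ![0, 2] g}

/-- Cohomologous cocycles: `g'_{ij} = h_i g_{ij} h_j⁻¹` for some `h ∈ C⁰(M, G_E)`. -/
def cohomologous (g g' : Z1G EB F E 𝔘) : Prop :=
  ∃ h ∈ geCochain EB F E 𝔘 0, g'.1 * pull EB F E 𝔘 ![1] h = pull EB F E 𝔘 ![0] h * g.1

/-- The pointed set `H¹(M, G_E)`. -/
def H1G : Type _ := Quot (cohomologous EB F E 𝔘)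

variable {EB F E}

/-- The class in `H¹(M, G_E)` of a cocycle. -/
def H1G.mk (g : Z1G EB F E 𝔘) : H1G EB F E 𝔘 := Quot.mk _ g

/-- The exponential of a cochain. The endomorphisms to which it is applied raise the degree, so
that their powers with exponent larger than `rk(E)` vanish and the sum is the full exponential
series. -/
def expo {q : ℕ} (u : Cochain EB F E 𝔘 q) : Cochain EB F E 𝔘 q :=
  ∑ n ∈ Finset.range (Module.finrank ℂ F + 1), ((n.factorial : ℂ)⁻¹) • u ^ n

/-- The projection `pr_{End_k(ΛE)}` onto the component which raises the degree by `k`. -/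
def prEnd {q : ℕ} (k : ℕ) (x : Cochain EB F E 𝔘 q) : Cochain EB F E 𝔘 q :=
  ∑ j ∈ Finset.range (Module.finrank ℂ F + 1),
    const EB F E 𝔘 q (projEnd EB F E (j + k)) * x * const EB F E 𝔘 q (projEnd EB F E j)

/-- The non-abelian coboundary `(𝐝g)_{ijk} = g_{ij} g_{jk} g_{ik}⁻¹`. -/
def dG (g : Cochain EB F E 𝔘 1) : Cochain EB F E 𝔘 2 :=
  pull EB F E 𝔘 ![0, 1] g * pull EB F E 𝔘 ![1, 2] g * Ring.inverse (pull EB F E 𝔘 ![0, 2] g)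

/-- `c_u = pr_{End_4(ΛE)}(𝐝 exp(u))`. -/
def cc (u : Cochain EB F E 𝔘 1) : Cochain EB F E 𝔘 2 := prEnd 𝔘 4 (dG 𝔘 (expo 𝔘 u))

variable (EB F E)

/-- `Z̃¹(M, Der_2(ΛE))`: those `u ∈ Z¹(M, Der_2(ΛE))` for which `c_u` lies in
`B²(M, Der_4(ΛE))`. -/
def Zt : Set (Cochain EB F E 𝔘 1) :=
  {u | u ∈ Z1 EB F E 𝔘 2 ∧ cc 𝔘 u ∈ B2 EB F E 𝔘 4}

/-- Cocycles in `Z̃¹(M, Der_2(ΛE))` that differ by an element of `B¹(M, Der_2(ΛE))`. -/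
def ztSetoid : Setoid (Zt EB F E 𝔘) where
  r u u' := u.1 - u'.1 ∈ B1 EB F E 𝔘 2
  iseqv :=
    { refl := fun u => by rw [sub_self]; exact zero_mem _
      symm := fun {u u'} h => by rw [← neg_sub]; exact neg_mem h
      trans := fun {u u' u''} h h' => by rw [← sub_add_sub_cancel]; exact add_mem h h' }

/-- The set `Z̃¹(M, Der_2(ΛE)) / B¹(M, Der_2(ΛE))`. -/
def ZtB : Type _ := Quotient (ztSetoid EB F E 𝔘)

variable {EB F E}

/-- The class in `Z̃¹(M, Der_2(ΛE)) / B¹(M, Der_2(ΛE))` of a cocycle. -/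
def ZtB.mk (u : Zt EB F E 𝔘) : ZtB EB F E 𝔘 := Quotient.mk (ztSetoid EB F E 𝔘) u

/-- `F(v, u)_{ij} = ½ ([v_i + v_j, u_{ij}] - [v_i, v_j])`. -/
def FF (v : Cochain EB F E 𝔘 0) (u : Cochain EB F E 𝔘 1) : Cochain EB F E 𝔘 1 :=
  (1 / 2 : ℂ) • (⁅pull EB F E 𝔘 (p := 1) ![0] v + pull EB F E 𝔘 (p := 1) ![1] v, u⁆
    - ⁅pull EB F E 𝔘 (p := 1) ![0] v, pull EB F E 𝔘 (p := 1) ![1] v⁆)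

/-! ### The action of `H⁰(M, Aut(E))` -/

theorem const_lamEnd_mul_inv (q : ℕ) (φ : AutE EB F E) :
    const EB F E 𝔘 q (lamEnd φ) * const EB F E 𝔘 q (lamEnd φ⁻¹) = 1 := by
  rw [← map_mul, lamEnd_mul_inv, map_one]

theorem const_lamEnd_inv_mul (q : ℕ) (φ : AutE EB F E) :
    const EB F E 𝔘 q (lamEnd φ⁻¹) * const EB F E 𝔘 q (lamEnd φ) = 1 := by
  rw [← map_mul, lamEnd_inv_mul, map_one]

/-- The action `φ.x = Λφ ∘ x ∘ Λφ⁻¹` of `φ ∈ H⁰(M, Aut(E))` on cochains. -/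
def act {q : ℕ} (φ : AutE EB F E) : Cochain EB F E 𝔘 q →ₐ[ℂ] Cochain EB F E 𝔘 q where
  toFun x := const EB F E 𝔘 q (lamEnd φ) * x * const EB F E 𝔘 q (lamEnd φ⁻¹)
  map_one' := by rw [mul_one, const_lamEnd_mul_inv]
  map_mul' x y := by
    simp only [mul_assoc]
    rw [← mul_assoc (const EB F E 𝔘 q (lamEnd φ⁻¹)) (const EB F E 𝔘 q (lamEnd φ)),
      const_lamEnd_inv_mul, one_mul]
  map_zero' := by rw [mul_zero, zero_mul]
  map_add' x y := by rw [mul_add, add_mul]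
  commutes' r := by
    rw [← Algebra.commutes, mul_assoc, const_lamEnd_mul_inv, mul_one]

theorem act_apply {q : ℕ} (φ : AutE EB F E) (x : Cochain EB F E 𝔘 q) :
    act 𝔘 φ x = const EB F E 𝔘 q (lamEnd φ) * x * const EB F E 𝔘 q (lamEnd φ⁻¹) := rfl

theorem act_inv_act {q : ℕ} (φ : AutE EB F E) (x : Cochain EB F E 𝔘 q) :
    act 𝔘 φ⁻¹ (act 𝔘 φ x) = x := by
  rw [act_apply, act_apply, inv_inv]
  simp only [mul_assoc]
  rw [const_lamEnd_inv_mul, mul_one, ← mul_assoc, const_lamEnd_inv_mul, one_mul]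

theorem act_ofCover {q : ℕ} (φ : AutE EB F E) (j : J) (f : CoverCochain EB F E 𝔘 q j) :
    act 𝔘 φ (ofCover EB F E 𝔘 q j f) = ofCover EB F E 𝔘 q j fun s => conjEnd φ _ (f s) := by
  rw [act_apply, const_eq EB F E 𝔘 q _ j, const_eq EB F E 𝔘 q _ j, ← map_mul, ← map_mul]
  rfl

theorem act_derCochain {q k : ℕ} (φ : AutE EB F E) {x : Cochain EB F E 𝔘 q}
    (hx : x ∈ derCochain EB F E 𝔘 q k) : act 𝔘 φ x ∈ derCochain EB F E 𝔘 q k := by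
  obtain ⟨j, f, hf, rfl⟩ := hx
  exact ⟨j, _, fun s => conjEnd_Der φ (hf s), act_ofCover 𝔘 φ j f⟩

theorem act_geCochain {q : ℕ} (φ : AutE EB F E) {x : Cochain EB F E 𝔘 q}
    (hx : x ∈ geCochain EB F E 𝔘 q) : act 𝔘 φ x ∈ geCochain EB F E 𝔘 q := by
  obtain ⟨j, f, hf, rfl⟩ := hx
  exact ⟨j, _, fun s => conjEnd_GE φ (hf s), act_ofCover 𝔘 φ j f⟩

theorem pull_const {p q : ℕ} (a : Fin (q + 1) → Fin (p + 1)) (f : ShEnd EB F E (⊤ : Opens M)) :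
    pull EB F E 𝔘 a (const EB F E 𝔘 q f) = const EB F E 𝔘 p f := rfl

theorem pull_act {p q : ℕ} (a : Fin (q + 1) → Fin (p + 1)) (φ : AutE EB F E)
    (x : Cochain EB F E 𝔘 q) :
    pull EB F E 𝔘 a (act 𝔘 φ x) = act 𝔘 φ (pull EB F E 𝔘 a x) := by
  rw [act_apply, act_apply, map_mul, map_mul, pull_const, pull_const]

theorem d0_act (φ : AutE EB F E) (x : Cochain EB F E 𝔘 0) :
    d0 EB F E 𝔘 (act 𝔘 φ x) = act 𝔘 φ (d0 EB F E 𝔘 x) := by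
  simp only [d0, LinearMap.sub_apply, AlgHom.toLinearMap_apply, pull_act, map_sub]

theorem d1_act (φ : AutE EB F E) (x : Cochain EB F E 𝔘 1) :
    d1 EB F E 𝔘 (act 𝔘 φ x) = act 𝔘 φ (d1 EB F E 𝔘 x) := by
  simp only [d1, LinearMap.sub_apply, LinearMap.add_apply, AlgHom.toLinearMap_apply, pull_act,
    map_sub, map_add]

theorem act_Z1 (φ : AutE EB F E) {k : ℕ} {x : Cochain EB F E 𝔘 1} (hx : x ∈ Z1 EB F E 𝔘 k) :
    act 𝔘 φ x ∈ Z1 EB F E 𝔘 k := by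
  refine ⟨act_derCochain 𝔘 φ hx.1, ?_⟩
  refine LinearMap.mem_ker.2 ?_
  rw [d1_act, LinearMap.mem_ker.1 hx.2, map_zero]

theorem act_B1 (φ : AutE EB F E) {k : ℕ} {x : Cochain EB F E 𝔘 1} (hx : x ∈ B1 EB F E 𝔘 k) :
    act 𝔘 φ x ∈ B1 EB F E 𝔘 k := by
  obtain ⟨v, hv, rfl⟩ := hx
  exact ⟨_, act_derCochain 𝔘 φ hv, d0_act 𝔘 φ v⟩

theorem act_B2 (φ : AutE EB F E) {k : ℕ} {x : Cochain EB F E 𝔘 2} (hx : x ∈ B2 EB F E 𝔘 k) :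
    act 𝔘 φ x ∈ B2 EB F E 𝔘 k := by
  obtain ⟨v, hv, rfl⟩ := hx
  exact ⟨_, act_derCochain 𝔘 φ hv, d1_act 𝔘 φ v⟩

theorem act_Z1G (φ : AutE EB F E) {g : Cochain EB F E 𝔘 1} (hg : g ∈ Z1G EB F E 𝔘) :
    act 𝔘 φ g ∈ Z1G EB F E 𝔘 := by
  refine ⟨act_geCochain 𝔘 φ hg.1, ?_⟩
  rw [pull_act, pull_act, pull_act, ← map_mul, hg.2]

theorem act_proj {q : ℕ} (φ : AutE EB F E) (j : ℕ) :
    act 𝔘 φ (const EB F E 𝔘 q (projEnd EB F E j)) = const EB F E 𝔘 q (projEnd EB F E j) := by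
  have h : lamEnd φ * projEnd EB F E j = projEnd EB F E j * lamEnd φ :=
    ShEnd.ext fun W _ s => lam_proj φ j W s
  rw [act_apply, ← map_mul, h, ← map_mul, mul_assoc, lamEnd_mul_inv, mul_one]

theorem act_expo {q : ℕ} (φ : AutE EB F E) (u : Cochain EB F E 𝔘 q) :
    act 𝔘 φ (expo 𝔘 u) = expo 𝔘 (act 𝔘 φ u) := by
  simp only [expo, map_sum, map_smul, map_pow]

theorem act_prEnd {q : ℕ} (φ : AutE EB F E) (k : ℕ) (x : Cochain EB F E 𝔘 q) :
    act 𝔘 φ (prEnd 𝔘 k x) = prEnd 𝔘 k (act 𝔘 φ x) := by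
  simp only [prEnd, map_sum, map_mul, act_proj]

theorem act_inverse {q : ℕ} (φ : AutE EB F E) (x : Cochain EB F E 𝔘 q) :
    act 𝔘 φ (Ring.inverse x) = Ring.inverse (act 𝔘 φ x) := by
  by_cases hx : IsUnit x
  · have h : act 𝔘 φ x * act 𝔘 φ (Ring.inverse x) = 1 := by
      rw [← map_mul, Ring.mul_inverse_cancel x hx, map_one]
    have h2 := Ring.inverse_mul_cancel _ (hx.map (act 𝔘 φ))
    rw [← one_mul (act 𝔘 φ (Ring.inverse x)), ← h2, mul_assoc, h, mul_one]
  · rw [Ring.inverse_non_unit _ hx, map_zero, Ring.inverse_non_unit]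
    intro h
    have h2 := h.map (act 𝔘 φ⁻¹)
    rw [act_inv_act] at h2
    exact hx h2

theorem act_cc (φ : AutE EB F E) (u : Cochain EB F E 𝔘 1) :
    act 𝔘 φ (cc 𝔘 u) = cc 𝔘 (act 𝔘 φ u) := by
  simp only [cc, dG, act_prEnd, map_mul, act_inverse, ← pull_act, act_expo]

theorem act_Zt (φ : AutE EB F E) {u : Cochain EB F E 𝔘 1} (hu : u ∈ Zt EB F E 𝔘) :
    act 𝔘 φ u ∈ Zt EB F E 𝔘 :=
  ⟨act_Z1 𝔘 φ hu.1, by rw [← act_cc]; exact act_B2 𝔘 φ hu.2⟩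

/-- The action of `H⁰(M, Aut(E))` on `H¹(M, G_E)`. -/
def actH1G (φ : AutE EB F E) : H1G EB F E 𝔘 → H1G EB F E 𝔘 :=
  Quot.map (fun g => ⟨act 𝔘 φ g.1, act_Z1G 𝔘 φ g.2⟩) (by
    rintro g g' ⟨h, hh, e⟩
    refine ⟨act 𝔘 φ h, act_geCochain 𝔘 φ hh, ?_⟩
    rw [pull_act, pull_act, ← map_mul, ← map_mul, e])

/-- The action of `H⁰(M, Aut(E))` on `Z̃¹(M, Der_2(ΛE)) / B¹(M, Der_2(ΛE))`. -/
def actZtB (φ : AutE EB F E) : ZtB EB F E 𝔘 → ZtB EB F E 𝔘 :=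
  Quotient.map' (fun u => ⟨act 𝔘 φ u.1, act_Zt 𝔘 φ u.2⟩) (by
    intro u u' h
    change act 𝔘 φ u.1 - act 𝔘 φ u'.1 ∈ B1 EB F E 𝔘 2
    rw [← map_sub]
    exact act_B1 𝔘 φ h)

/-- The action of `H⁰(M, Aut(E))` on `H¹(M, Der_k(ΛE))`. -/
def actH1Der (k : ℕ) (φ : AutE EB F E) : H1Der EB F E 𝔘 k →ₗ[ℂ] H1Der EB F E 𝔘 k :=
  Submodule.mapQ _ _
    ((act 𝔘 φ).toLinearMap.restrict (p := Z1 EB F E 𝔘 k) (q := Z1 EB F E 𝔘 k)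
      fun _ hx => act_Z1 𝔘 φ hx)
    fun _ hx => act_B1 𝔘 φ hx

/-! ### Strongly compatible maps -/

variable (EB F E) in
/-- A map `D : H⁰(M, Aut(E)) × C⁰(M, Der_2(ΛE)) × Z̃¹(M, Der_2(ΛE)) → C¹(M, Der_4(ΛE))` is given by
a function on all triples, of which only the values on this domain matter.

It is compatible if `d(D(φ, v, u)) = c_u` and `φ.D(φ, v, u) = D(Id, 0, φ.u + d(φ.v)) + F(φ.v, φ.u)`,
and strongly compatible if in addition `φ.D(φ, v, u)` and `D(Id, 0, φ.u)` agree up to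
`B¹(M, Der_4(ΛE))`. -/
structure StronglyCompatible
    (D : AutE EB F E → Cochain EB F E 𝔘 0 → Cochain EB F E 𝔘 1 → Cochain EB F E 𝔘 1) : Prop where
  mem : ∀ φ, ∀ v ∈ derCochain EB F E 𝔘 0 2, ∀ u ∈ Zt EB F E 𝔘, D φ v u ∈ derCochain EB F E 𝔘 1 4
  coboundary : ∀ φ, ∀ v ∈ derCochain EB F E 𝔘 0 2, ∀ u ∈ Zt EB F E 𝔘,
    d1 EB F E 𝔘 (D φ v u) = cc 𝔘 u
  compat : ∀ φ, ∀ v ∈ derCochain EB F E 𝔘 0 2, ∀ u ∈ Zt EB F E 𝔘,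
    act 𝔘 φ (D φ v u) =
      D 1 0 (act 𝔘 φ u + d0 EB F E 𝔘 (act 𝔘 φ v)) + FF 𝔘 (act 𝔘 φ v) (act 𝔘 φ u)
  strong : ∀ φ, ∀ v ∈ derCochain EB F E 𝔘 0 2, ∀ u ∈ Zt EB F E 𝔘,
    act 𝔘 φ (D φ v u) - D 1 0 (act 𝔘 φ u) ∈ B1 EB F E 𝔘 4

end Cochains

end SplitSuper

end

/-!
Since the rank is at most `5`, an operator on `𝒪_{ΛE}` that raises the degree by `6` or more is zero.
Hence `exp(x + y) = 1 + x + y + ½ x²` for derivations `x` of degree `2` and `y` of degree `4`, and the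
Baker–Campbell–Hausdorff formula has a single bracket term (`exp24_mul`):
`exp(x + y) exp(x' + y') = exp((x + x') + (y + y' + ½ [x, x']))`. Moreover `x` and `y` can be read off
from the exponential by comparing degrees (`exp24_inj`).

Every section `g` of `G_E` is such an exponential (`exists_exp24_of_mem_GE`): comparing degrees in
`g(st) = g(s) g(t)` shows that the degree `2` component `x` of `g` is a derivation, and that the degree
`4` component becomes one after subtraction of `½ x²`. The converse is `exp24_mem_GE`.

The non-abelian cochain calculus is thereby reduced to identities between brackets.
* For a cocycle `u` one has `c_u = ½ [u_{ij}, u_{jk}]` (`cc_eq`), and `exp(x + y)` is a cocycle iff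
  `dx = 0` and `dy = -c_x` (`exp24_mem_Z1G_iff`).
* `exp(x + y)` and `exp(x' + y')` are cohomologous iff `x' = x + dv` and `y' = y + dw + F(v, x)` for
  some `v`, `w` (`cohomologous_iff`).

If `D` is strongly compatible, then `d(D(Id, 0, x)) = c_x`, so that `D(Id, 0, x) + y` is a cocycle, and
`D(Id, 0, x + dv) + F(v, x)` is `D(Id, 0, x)` up to a coboundary. So the class of
`D(Id, 0, x) + y` depends only on the class of `exp(x + y)`, and `σ_D` is well defined and bijective
(`exists_classification`).

For the existence of `D`, the conditions for general `(φ, v)` follow from those on `D(Id, 0, ·)`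
(`exists_stronglyCompatible`). The latter is chosen on one representative `u₀` of each class and
extended by `D(Id, 0, u₀ + dv) = D(Id, 0, u₀) - F(v, u₀)` (`exists_primitive`). This makes sense because
`v` is determined by `dv`: a cochain `v` with `dv = 0` glues to a global derivation
(`eq_zero_of_d0_eq_zero`), which is zero by hypothesis. It satisfies the conditions because `F` obeys
a cocycle rule up to the coboundary of `½ [w, v]` (`FF_add`).
-/

open scoped Manifold ContDiff
open TopologicalSpace Bundle

noncomputable section

namespace SplitSuper

/-! ### Algebras of operators on a graded space -/

section Graded

variable {A : Type*} [Ring A]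

/-- `P 0, …, P n` are the projections of a grading with finitely many degrees `0, …, n`: orthogonal
idempotents with sum `1`. The sequence is continued by zero. -/
structure IsGrading (n : ℕ) (P : ℕ → A) : Prop where
  mul_self : ∀ i, P i * P i = P i
  mul_of_ne : ∀ i j, i ≠ j → P i * P j = 0
  sum_eq_one : ∑ j ∈ Finset.range (n + 1), P j = 1
  eq_zero : ∀ j, n < j → P j = 0

variable [Algebra ℂ A] {n : ℕ} {P : ℕ → A}

/-- The operators that raise the degree by `k`. -/
def raising (P : ℕ → A) (k : ℕ) : Submodule ℂ A where
  carrier := {x | ∀ j, x * P j = P (j + k) * x}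
  add_mem' ha hb j := by rw [add_mul, mul_add, ha j, hb j]
  zero_mem' j := by rw [zero_mul, mul_zero]
  smul_mem' c _ ha j := by rw [smul_mul_assoc, mul_smul_comm, ha j]

theorem one_mem_raising : (1 : A) ∈ raising P 0 := fun j => by rw [one_mul, mul_one, add_zero]

theorem mul_mem_raising {k l : ℕ} {x y : A} (hx : x ∈ raising P k) (hy : y ∈ raising P l) :
    x * y ∈ raising P (k + l) := fun j => by
  rw [mul_assoc, hy j, ← mul_assoc, hx (j + l), mul_assoc, add_assoc, add_comm l k]

theorem eq_zero_of_mem_raising (hP : IsGrading n P) {k : ℕ} (hk : n < k) {x : A}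
    (hx : x ∈ raising P k) : x = 0 := by
  rw [← mul_one x, ← hP.sum_eq_one, Finset.mul_sum]
  refine Finset.sum_eq_zero fun j _ => ?_
  rw [hx j, hP.eq_zero _ (by omega), zero_mul]

/-- The component of an operator that raises the degree by `k`. -/
def component (n : ℕ) (P : ℕ → A) (k : ℕ) : A →ₗ[ℂ] A where
  toFun x := ∑ j ∈ Finset.range (n + 1), P (j + k) * x * P j
  map_add' x y := by simp only [mul_add, add_mul, Finset.sum_add_distrib]
  map_smul' c x := by
    simp only [mul_smul_comm, smul_mul_assoc, Finset.smul_sum, RingHom.id_apply]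

theorem component_apply (k : ℕ) (x : A) :
    component n P k x = ∑ j ∈ Finset.range (n + 1), P (j + k) * x * P j := rfl

theorem component_of_mem (hP : IsGrading n P) {k : ℕ} {x : A} (hx : x ∈ raising P k) :
    component n P k x = x := by
  conv_rhs => rw [← mul_one x, ← hP.sum_eq_one, Finset.mul_sum]
  rw [component_apply]
  refine Finset.sum_congr rfl fun j _ => ?_
  rw [← hx j, mul_assoc, hP.mul_self]

theorem component_of_mem_ne (hP : IsGrading n P) {k l : ℕ} (hkl : k ≠ l) {x : A}
    (hx : x ∈ raising P k) : component n P l x = 0 := by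
  rw [component_apply]
  refine Finset.sum_eq_zero fun j _ => ?_
  rw [mul_assoc, hx j, ← mul_assoc, hP.mul_of_ne _ _ (by omega), zero_mul]

theorem component_mul (hP : IsGrading n P) (k j : ℕ) (x : A) :
    component n P k x * P j = P (j + k) * x * P j := by
  by_cases hj : j ≤ n
  · rw [component_apply, Finset.sum_mul, Finset.sum_eq_single j]
    · rw [mul_assoc, hP.mul_self]
    · intro i _ hij
      rw [mul_assoc, hP.mul_of_ne _ _ hij, mul_zero]
    · intro h
      exact absurd (Finset.mem_range.2 (by omega)) h
  · rw [hP.eq_zero j (by omega), mul_zero, mul_zero]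

/-- For `x` of degree `2` and `y` of degree `4`, and if there are no operators of degree `≥ 6`, the
full exponential series of `x + y`. -/
def exp24 (x y : A) : A := 1 + x + y + (1 / 2 : ℂ) • (x * x)

variable {x x' y y' : A}

/-- In degrees `2` and `4`, the Baker–Campbell–Hausdorff formula has only one bracket term. -/
theorem exp24_mul (hP : IsGrading n P) (hn : n < 6) (hx : x ∈ raising P 2) (hy : y ∈ raising P 4)
    (hx' : x' ∈ raising P 2) (hy' : y' ∈ raising P 4) :
    exp24 x y * exp24 x' y' = exp24 (x + x') (y + y' + (1 / 2 : ℂ) • ⁅x, x'⁆) := by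
  have z : ∀ {k : ℕ} {z : A}, z ∈ raising P k → 6 ≤ k → z = 0 := fun h hk =>
    eq_zero_of_mem_raising hP (by omega) h
  have h4 := mul_mem_raising hx hx
  have h4' := mul_mem_raising hx' hx'
  have e1 := z (mul_mem_raising hx hy') (by norm_num)
  have e2 := z (mul_mem_raising hx h4') (by norm_num)
  have e3 := z (mul_mem_raising hy hx') (by norm_num)
  have e4 := z (mul_mem_raising hy hy') (by norm_num)
  have e5 := z (mul_mem_raising hy h4') (by norm_num)
  have e6 := z (mul_mem_raising h4 hx') (by norm_num)
  have e7 := z (mul_mem_raising h4 hy') (by norm_num)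
  have e8 := z (mul_mem_raising h4 h4') (by norm_num)
  simp only [exp24, mul_add, add_mul, mul_one, one_mul, smul_mul_assoc, mul_smul_comm, e1, e2, e3,
    e4, e5, e6, e7, e8, Ring.lie_def]
  module

theorem exp24_zero : exp24 (0 : A) 0 = 1 := by simp [exp24]

theorem exp24_mul_neg (hP : IsGrading n P) (hn : n < 6) (hx : x ∈ raising P 2)
    (hy : y ∈ raising P 4) : exp24 x y * exp24 (-x) (-y) = 1 := by
  rw [exp24_mul hP hn hx hy (neg_mem hx) (neg_mem hy), Ring.lie_def]
  simp [exp24_zero]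

theorem exp24_neg_mul (hP : IsGrading n P) (hn : n < 6) (hx : x ∈ raising P 2)
    (hy : y ∈ raising P 4) : exp24 (-x) (-y) * exp24 x y = 1 := by
  simpa using exp24_mul_neg hP hn (neg_mem hx) (neg_mem hy)

theorem component_two_exp24 (hP : IsGrading n P) (hx : x ∈ raising P 2) (hy : y ∈ raising P 4) :
    component n P 2 (exp24 x y) = x := by
  have h4 := Submodule.smul_mem _ (1 / 2 : ℂ) (mul_mem_raising hx hx)
  rw [exp24, map_add, map_add, map_add, component_of_mem_ne hP (by norm_num) one_mem_raising,
    component_of_mem hP hx, component_of_mem_ne hP (by norm_num) hy,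
    component_of_mem_ne hP (by norm_num) h4, zero_add, add_zero, add_zero]

theorem component_four_exp24 (hP : IsGrading n P) (hx : x ∈ raising P 2) (hy : y ∈ raising P 4) :
    component n P 4 (exp24 x y) = y + (1 / 2 : ℂ) • (x * x) := by
  have h4 := Submodule.smul_mem _ (1 / 2 : ℂ) (mul_mem_raising hx hx)
  rw [exp24, map_add, map_add, map_add, component_of_mem_ne hP (by norm_num) one_mem_raising,
    component_of_mem_ne hP (by norm_num) hx, component_of_mem hP hy, component_of_mem hP h4,
    zero_add, zero_add]

theorem exp24_inj (hP : IsGrading n P) (hx : x ∈ raising P 2) (hy : y ∈ raising P 4)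
    (hx' : x' ∈ raising P 2) (hy' : y' ∈ raising P 4) :
    exp24 x y = exp24 x' y' ↔ x = x' ∧ y = y' := by
  refine ⟨fun h => ?_, fun h => by rw [h.1, h.2]⟩
  have h2 : x = x' := by
    rw [← component_two_exp24 hP hx hy, h, component_two_exp24 hP hx' hy']
  refine ⟨h2, ?_⟩
  have h4 := congrArg (component n P 4) h
  rwa [component_four_exp24 hP hx hy, component_four_exp24 hP hx' hy', h2, add_left_inj] at h4

theorem sum_range_exp (hP : IsGrading n P) (hn : n < 6) (hn' : 2 ≤ n) (hx : x ∈ raising P 2)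
    (hy : y ∈ raising P 4) :
    ∑ m ∈ Finset.range (n + 1), ((m.factorial : ℂ)⁻¹) • (x + y) ^ m = exp24 x y := by
  have z : ∀ {k : ℕ} {z : A}, z ∈ raising P k → 6 ≤ k → z = 0 := fun h hk =>
    eq_zero_of_mem_raising hP (by omega) h
  have e2 : (x + y) ^ 2 = x * x := by
    rw [sq, mul_add, add_mul, add_mul, z (mul_mem_raising hx hy) (by norm_num),
      z (mul_mem_raising hy hx) (by norm_num), z (mul_mem_raising hy hy) (by norm_num)]
    simp
  have e3 : (x + y) ^ 3 = 0 := by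
    rw [pow_succ, e2, mul_add,
      z (mul_mem_raising (mul_mem_raising hx hx) hx) (by norm_num),
      z (mul_mem_raising (mul_mem_raising hx hx) hy) (by norm_num), add_zero]
  obtain ⟨m, rfl⟩ : ∃ m, n = m + 2 := ⟨n - 2, by omega⟩
  rw [show m + 2 + 1 = 3 + m by omega, Finset.sum_range_add, Finset.sum_eq_zero (s := .range m)]
  · simp [Finset.sum_range_succ, e2, exp24, add_assoc]
  · intro i _
    rw [pow_add, e3, zero_mul, smul_zero]

theorem IsGrading.map {A B : Type*} [Ring A] [Ring B] {n : ℕ} {P : ℕ → A} (hP : IsGrading n P)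
    (f : A →+* B) : IsGrading n fun j => f (P j) where
  mul_self i := by rw [← map_mul, hP.mul_self]
  mul_of_ne i j h := by rw [← map_mul, hP.mul_of_ne i j h, map_zero]
  sum_eq_one := by rw [← map_sum, hP.sum_eq_one, map_one]
  eq_zero j h := by rw [hP.eq_zero j h, map_zero]

theorem map_exp24 {A B : Type*} [Ring A] [Algebra ℂ A] [Ring B] [Algebra ℂ B] (f : A →ₐ[ℂ] B)
    (x y : A) : f (exp24 x y) = exp24 (f x) (f y) := by
  simp only [exp24, map_add, map_one, map_smul, map_mul]

end Graded

/-! ### The grading of `𝒪_{ΛE}` -/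

section SheafGrading

theorem exteriorPower_eq_zero {V : Type*} [AddCommGroup V] [Module ℂ V] [FiniteDimensional ℂ V]
    {j : ℕ} (hj : Module.finrank ℂ V < j) {a : ExteriorAlgebra ℂ V} (ha : a ∈ ⋀[ℂ]^j V) :
    a = 0 := by
  have h : Module.finrank ℂ (⋀[ℂ]^j V) = 0 := by
    rw [exteriorPower.finrank_eq, Nat.choose_eq_zero_of_lt hj]
  exact congrArg Subtype.val
    (@Subsingleton.elim _ (Module.finrank_zero_iff.1 h) (⟨a, ha⟩ : ⋀[ℂ]^j V) 0)

theorem sum_range_decompose {V : Type*} [AddCommGroup V] [Module ℂ V] [FiniteDimensional ℂ V]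
    (a : ExteriorAlgebra ℂ V) :
    ∑ j ∈ Finset.range (Module.finrank ℂ V + 1),
      (DirectSum.decompose (fun i : ℕ => ⋀[ℂ]^i V) a j : ExteriorAlgebra ℂ V) = a := by
  classical
  conv_rhs => rw [← DirectSum.sum_support_decompose (fun i : ℕ => ⋀[ℂ]^i V) a]
  refine (Finset.sum_subset (fun j hj => ?_) fun j _ hj => ?_).symm
  · by_contra h
    refine (DFinsupp.mem_support_iff.1 hj) (Subtype.ext ?_)
    exact exteriorPower_eq_zero (by simpa using h) (SetLike.coe_mem _)
  · rw [DFinsupp.notMem_support_iff.1 hj]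
    rfl

variable {EB : Type*} [NormedAddCommGroup EB] [NormedSpace ℂ EB]
  {M : Type*} [TopologicalSpace M] [ChartedSpace EB M]
  {F : Type*} [NormedAddCommGroup F] [NormedSpace ℂ F]
  {E : M → Type*} [∀ x, AddCommGroup (E x)] [∀ x, Module ℂ (E x)]
  [∀ x, TopologicalSpace (E x)] [TopologicalSpace (TotalSpace F E)] [FiberBundle F E]

theorem Sec.ext {V : Opens M} {s t : Sec EB F E V} (h : ∀ x, s.1 x = t.1 x) : s = t :=
  Subtype.ext (funext h)

theorem proj_mem_gr (j : ℕ) {V : Opens M} (s : Sec EB F E V) :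
    proj EB F E j V s ∈ gr EB F E j V := fun _ => SetLike.coe_mem _

theorem proj_of_mem {j : ℕ} {V : Opens M} {s : Sec EB F E V} (hs : s ∈ gr EB F E j V) :
    proj EB F E j V s = s :=
  Sec.ext fun x => DirectSum.decompose_of_mem_same (fun i : ℕ => ⋀[ℂ]^i (E x)) (hs x)

theorem proj_of_mem_ne {i j : ℕ} (hij : i ≠ j) {V : Opens M} {s : Sec EB F E V}
    (hs : s ∈ gr EB F E i V) : proj EB F E j V s = 0 :=
  Sec.ext fun x => DirectSum.decompose_of_mem_ne (fun i : ℕ => ⋀[ℂ]^i (E x)) (hs x) hij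

theorem mul_mem_gr {i j k : ℕ} (h : i + j = k) {V : Opens M} {s t : Sec EB F E V}
    (hs : s ∈ gr EB F E i V) (ht : t ∈ gr EB F E j V) : s * t ∈ gr EB F E k V := fun x =>
  h ▸ SetLike.mul_mem_graded (A := fun i : ℕ => ⋀[ℂ]^i (E x)) (hs x) (ht x)

/-- The value of a section at a point. -/
def Sec.eval (V : Opens M) (x : V) : Sec EB F E V →ₐ[ℂ] ExteriorAlgebra ℂ (E x) :=
  (Pi.evalAlgHom ℂ (fun x : V => ExteriorAlgebra ℂ (E x)) x).comp (O EB F E V).val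

/-- Taking the component on an open set, as a homomorphism of algebras. -/
def ShEnd.appAlgHom {U : Opens M} (W : Opens M) (hW : W ≤ U) :
    ShEnd EB F E U →ₐ[ℂ] Module.End ℂ (Sec EB F E W) where
  toFun f := f.app W hW
  map_one' := rfl
  map_mul' _ _ := rfl
  map_zero' := rfl
  map_add' _ _ := rfl
  commutes' _ := rfl

variable (EB F E) in
/-- The projection onto `𝒪_{Λ^j E}` on an open set. -/
def localProj (U : Opens M) (j : ℕ) : ShEnd EB F E U := resEnd EB F E le_top (projEnd EB F E j)

theorem localProj_app {U : Opens M} (j : ℕ) (W : Opens M) (hW : W ≤ U) (s : Sec EB F E W) :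
    (localProj EB F E U j).app W hW s = proj EB F E j W s := rfl

theorem ShEnd.mul_app {U : Opens M} (f g : ShEnd EB F E U) (W : Opens M) (hW : W ≤ U)
    (s : Sec EB F E W) : (f * g).app W hW s = f.app W hW (g.app W hW s) := rfl

theorem ShEnd.add_app {U : Opens M} (f g : ShEnd EB F E U) (W : Opens M) (hW : W ≤ U)
    (s : Sec EB F E W) : (f + g).app W hW s = f.app W hW s + g.app W hW s := rfl

theorem ShEnd.sub_app {U : Opens M} (f g : ShEnd EB F E U) (W : Opens M) (hW : W ≤ U)
    (s : Sec EB F E W) : (f - g).app W hW s = f.app W hW s - g.app W hW s := rfl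

theorem ShEnd.smul_app {U : Opens M} (c : ℂ) (f : ShEnd EB F E U) (W : Opens M) (hW : W ≤ U)
    (s : Sec EB F E W) : (c • f).app W hW s = c • f.app W hW s := rfl

theorem gr_inj {V : Opens M} {i j : ℕ} (hij : i ≠ j) {a a' b b' : Sec EB F E V}
    (ha : a ∈ gr EB F E i V) (ha' : a' ∈ gr EB F E i V) (hb : b ∈ gr EB F E j V)
    (hb' : b' ∈ gr EB F E j V) (h : a + b = a' + b') : a = a' ∧ b = b' := by
  have e := congrArg (proj EB F E i V) h
  rw [map_add, map_add, proj_of_mem ha, proj_of_mem ha', proj_of_mem_ne hij.symm hb,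
    proj_of_mem_ne hij.symm hb', add_zero, add_zero] at e
  subst e
  exact ⟨rfl, add_left_cancel h⟩

theorem lie_mem_Der {U : Opens M} {k l : ℕ} {f g : ShEnd EB F E U} (hf : f ∈ Der EB F E k U)
    (hg : g ∈ Der EB F E l U) : ⁅f, g⁆ ∈ Der EB F E (k + l) U := by
  intro W hW
  rw [Ring.lie_def]
  obtain ⟨f1, f2⟩ := hf W hW
  obtain ⟨g1, g2⟩ := hg W hW
  refine ⟨fun s t => ?_, fun j s hs => ?_⟩
  · simp only [ShEnd.sub_app, ShEnd.mul_app, f1, g1, map_add]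
    noncomm_ring
  · rw [ShEnd.sub_app, ShEnd.mul_app, ShEnd.mul_app]
    refine sub_mem ?_ ?_
    · rw [add_comm k l, ← add_assoc]
      exact f2 _ _ (g2 _ _ hs)
    · rw [← add_assoc]
      exact g2 _ _ (f2 _ _ hs)

/-- The exponential of a derivation with vanishing third power is multiplicative. The unwanted terms
of the product are multiples of the third and fourth power of the derivation at `s * t`. -/
theorem exp_derivation_mul {B : Type*} [Ring B] [Algebra ℂ B] (u : Module.End ℂ B)
    (hu : ∀ s t, u (s * t) = u s * t + s * u t) (h3 : ∀ s, u (u (u s)) = 0) (s t : B) :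
    s * t + u (s * t) + (1 / 2 : ℂ) • u (u (s * t)) =
      (s + u s + (1 / 2 : ℂ) • u (u s)) * (t + u t + (1 / 2 : ℂ) • u (u t)) := by
  have e3 := h3 (s * t)
  have e4 := congrArg u (h3 (s * t))
  simp only [hu, map_add, h3, map_zero, mul_zero, zero_mul, zero_add, add_zero] at e3 e4 ⊢
  have e3' : u (u s) * u t + u s * u (u t) = 0 := by
    have h : (3 : ℂ) • (u (u s) * u t + u s * u (u t)) = 0 := by
      rw [← e3]; module
    exact (smul_eq_zero.1 h).resolve_left (by norm_num)
  have e4' : u (u s) * u (u t) = 0 := by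
    have h : (6 : ℂ) • (u (u s) * u (u t)) = 0 := by
      rw [← e4]; module
    exact (smul_eq_zero.1 h).resolve_left (by norm_num)
  have e5 : u (u s) * u t = - (u s * u (u t)) := eq_neg_of_add_eq_zero_left e3'
  simp only [mul_add, add_mul, smul_mul_assoc, mul_smul_comm, e4', e5]
  module

variable [VectorBundle ℂ F E] [FiniteDimensional ℂ F]

variable (F) in
theorem finrank_fiber (x : M) : FiniteDimensional ℂ (E x) ∧
    Module.finrank ℂ (E x) = Module.finrank ℂ F := by
  have e := (trivializationAt F E x).linearEquivAt ℂ x (mem_baseSet_trivializationAt F E x)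
  exact ⟨e.symm.finiteDimensional, e.finrank_eq⟩

theorem eq_zero_of_mem_gr {j : ℕ} (hj : Module.finrank ℂ F < j) {V : Opens M} {s : Sec EB F E V}
    (hs : s ∈ gr EB F E j V) : s = 0 :=
  Sec.ext fun x => by
    obtain ⟨_, h⟩ := finrank_fiber F (E := E) x.1
    exact exteriorPower_eq_zero (h ▸ hj) (hs x)

theorem sum_proj {V : Opens M} (s : Sec EB F E V) :
    ∑ j ∈ Finset.range (Module.finrank ℂ F + 1), proj EB F E j V s = s :=
  Sec.ext fun x => by
    obtain ⟨_, h⟩ := finrank_fiber F (E := E) x.1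
    refine (map_sum (Sec.eval V x) _ _).trans ?_
    rw [← h]
    exact sum_range_decompose (s.1 x)

variable (EB F E) in
theorem isGrading_localProj (U : Opens M) :
    IsGrading (Module.finrank ℂ F) (localProj EB F E U) where
  mul_self i := ShEnd.ext fun _ _ s => proj_of_mem (proj_mem_gr i s)
  mul_of_ne i j h := ShEnd.ext fun _ _ s => proj_of_mem_ne h.symm (proj_mem_gr j s)
  sum_eq_one := ShEnd.ext fun W hW s => by
    have h := map_sum (ShEnd.appAlgHom (EB := EB) (F := F) (E := E) W hW) (localProj EB F E U)
      (Finset.range (Module.finrank ℂ F + 1))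
    refine (LinearMap.congr_fun h s).trans ?_
    rw [LinearMap.sum_apply]
    exact sum_proj s
  eq_zero j h := ShEnd.ext fun _ _ s => eq_zero_of_mem_gr h (proj_mem_gr j s)

theorem Sec.induction {V : Opens M} {p : Sec EB F E V → Prop}
    (hgr : ∀ j, ∀ s ∈ gr EB F E j V, p s) (hadd : ∀ s t, p s → p t → p (s + t))
    (s : Sec EB F E V) : p s := by
  rw [← sum_proj s]
  exact Finset.sum_induction _ p hadd (hgr 0 0 (zero_mem _)) fun j _ => hgr j _ (proj_mem_gr j s)

theorem mem_raising_of_gr {U : Opens M} {k : ℕ} {f : ShEnd EB F E U}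
    (hf : ∀ W hW j, ∀ s ∈ gr EB F E j W, f.app W hW s ∈ gr EB F E (j + k) W) :
    f ∈ raising (localProj EB F E U) k := by
  refine fun j => ShEnd.ext fun W hW s => ?_
  rw [ShEnd.mul_app, ShEnd.mul_app, localProj_app, localProj_app]
  induction s using Sec.induction with
  | hgr i s hs =>
    by_cases hij : i = j
    · subst hij
      rw [proj_of_mem hs, proj_of_mem (hf W hW i s hs)]
    · rw [proj_of_mem_ne hij hs, proj_of_mem_ne (by omega) (hf W hW i s hs), map_zero]
  | hadd s t h h' => rw [map_add, map_add, h, h', map_add, map_add]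

theorem component_app {U : Opens M} (k : ℕ) (f : ShEnd EB F E U) {W : Opens M} (hW : W ≤ U)
    {j : ℕ} {s : Sec EB F E W} (hs : s ∈ gr EB F E j W) :
    (component (Module.finrank ℂ F) (localProj EB F E U) k f).app W hW s =
      proj EB F E (j + k) W (f.app W hW s) := by
  have h := congrArg (fun g => ShEnd.app g W hW s)
    (component_mul (isGrading_localProj EB F E U) k j f)
  simp only [ShEnd.mul_app, localProj_app, proj_of_mem hs] at h
  exact h

/-! ### Exponentials of derivations and logarithms of automorphisms -/

theorem Der_le_raising (k : ℕ) (U : Opens M) :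
    Der EB F E k U ≤ (raising (localProj EB F E U) k) := fun _ hf =>
  mem_raising_of_gr fun W hW => (hf W hW).2

/-- Exponentials of derivations of degree `2` and `4` are sections of `G_E`. -/
theorem exp24_mem_GE (hn : Module.finrank ℂ F < 6) {U : Opens M} {x y : ShEnd EB F E U}
    (hx : x ∈ Der EB F E 2 U) (hy : y ∈ Der EB F E 4 U) : exp24 x y ∈ GE EB F E U := by
  have hP := isGrading_localProj EB F E U
  have rx := Der_le_raising 2 U hx
  have ry := Der_le_raising 4 U hy
  have z : ∀ {k : ℕ} {z : ShEnd EB F E U}, z ∈ raising (localProj EB F E U) k → 6 ≤ k → z = 0 :=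
    fun h hk => eq_zero_of_mem_raising hP (by omega) h
  have e2 : (x + y) * (x + y) = x * x := by
    rw [mul_add, add_mul, add_mul, z (mul_mem_raising rx ry) (by norm_num),
      z (mul_mem_raising ry rx) (by norm_num), z (mul_mem_raising ry ry) (by norm_num)]
    simp
  have e3 : (x + y) * ((x + y) * (x + y)) = 0 := by
    rw [e2, add_mul, z (mul_mem_raising rx (mul_mem_raising rx rx)) (by norm_num),
      z (mul_mem_raising ry (mul_mem_raising rx rx)) (by norm_num), add_zero]
  refine ⟨⟨⟨exp24 x y, exp24 (-x) (-y), exp24_mul_neg hP hn rx ry, exp24_neg_mul hP hn rx ry⟩,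
    rfl⟩, fun W hW => ?_⟩
  have app1 : ∀ s, (exp24 x y).app W hW s =
      s + (x.app W hW s + y.app W hW s + (1 / 2 : ℂ) • x.app W hW (x.app W hW s)) := by
    intro s
    rw [← add_assoc, ← add_assoc]
    rfl
  obtain ⟨x1, x2⟩ := hx W hW
  obtain ⟨y1, y2⟩ := hy W hW
  have x0 : x.app W hW 1 = 0 := by simpa using x1 1 1
  have y0 : y.app W hW 1 = 0 := by simpa using y1 1 1
  have hx2 : ∀ i, ∀ s ∈ gr EB F E i W, x.app W hW (x.app W hW s) ∈ gr EB F E (i + 4) W :=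
    fun i s hs => x2 _ _ (x2 _ _ hs)
  refine ⟨?_, fun s t => ?_, fun s hs => ?_, fun s hs => ?_, fun j s hs => ?_⟩
  · rw [app1, x0, y0, map_zero, smul_zero, add_zero, add_zero, add_zero]
  · have app2 : ∀ s, (exp24 x y).app W hW s = s + (x + y).app W hW s +
        (1 / 2 : ℂ) • (x + y).app W hW ((x + y).app W hW s) := by
      intro s
      rw [← ShEnd.mul_app, e2, app1, ShEnd.add_app, ShEnd.mul_app, add_assoc, add_assoc, add_assoc]
    rw [app2, app2, app2]
    refine exp_derivation_mul _ (fun s t => ?_) (fun s => ?_) s t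
    · rw [ShEnd.add_app, ShEnd.add_app, ShEnd.add_app, x1, y1, add_mul, mul_add]
      abel
    · exact congrArg (fun g => ShEnd.app g W hW s) e3
  · refine (iSup_le fun i s hs => ?_ : (⨆ i : ℕ, gr EB F E (2 * i) W) ≤
      (⨆ i : ℕ, gr EB F E (2 * i) W).comap ((exp24 x y).app W hW)) hs
    rw [Submodule.mem_comap, app1]
    have m := fun i => le_iSup (fun i => gr EB F E (2 * i) W) i
    exact add_mem (m i hs) (add_mem (add_mem (m (i + 1) (x2 _ _ hs)) (m (i + 2) (y2 _ _ hs)))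
      (Submodule.smul_mem _ _ (m (i + 2) (hx2 _ _ hs))))
  · refine (iSup_le fun i s hs => ?_ : (⨆ i : ℕ, gr EB F E (2 * i + 1) W) ≤
      (⨆ i : ℕ, gr EB F E (2 * i + 1) W).comap ((exp24 x y).app W hW)) hs
    rw [Submodule.mem_comap, app1]
    have m := fun i => le_iSup (fun i => gr EB F E (2 * i + 1) W) i
    have c2 : 2 * i + 1 + 2 = 2 * (i + 1) + 1 := by ring
    have c4 : 2 * i + 1 + 4 = 2 * (i + 2) + 1 := by ring
    exact add_mem (m i hs) (add_mem (add_mem (m (i + 1) (c2 ▸ x2 _ _ hs))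
      (m (i + 2) (c4 ▸ y2 _ _ hs))) (Submodule.smul_mem _ _ (m (i + 2) (c4 ▸ hx2 _ _ hs))))
  · rw [app1, add_sub_cancel_left]
    have m := fun k => le_iSup (fun k => gr EB F E (j + 2 * (k + 1)) W) k
    exact add_mem (add_mem (m 0 (x2 _ _ hs)) (m 1 (y2 _ _ hs)))
      (Submodule.smul_mem _ _ (m 1 (hx2 _ _ hs)))

/-- Every automorphism in `G_E` has a logarithm: if `x` and `w` are its components of degree `2` and
`4`, then `x` and `w - ½ x²` are derivations. -/
theorem exists_exp24_of_mem_GE (hn : Module.finrank ℂ F < 6) {U : Opens M} {g : ShEnd EB F E U}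
    (hg : g ∈ GE EB F E U) :
    ∃ x ∈ Der EB F E 2 U, ∃ y ∈ Der EB F E 4 U, g = exp24 x y := by
  set x := component (Module.finrank ℂ F) (localProj EB F E U) 2 g with hx
  set w := component (Module.finrank ℂ F) (localProj EB F E U) 4 g with hw
  have x2 : ∀ W hW j, ∀ s ∈ gr EB F E j W, x.app W hW s ∈ gr EB F E (j + 2) W := by
    intro W hW j s hs
    rw [hx, component_app 2 g hW hs]
    exact proj_mem_gr _ _
  have w4 : ∀ W hW j, ∀ s ∈ gr EB F E j W, w.app W hW s ∈ gr EB F E (j + 4) W := by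
    intro W hW j s hs
    rw [hw, component_app 4 g hW hs]
    exact proj_mem_gr _ _
  have z : ∀ {W : Opens M} {j : ℕ} {s : Sec EB F E W}, s ∈ gr EB F E j W → 6 ≤ j → s = 0 :=
    fun hs hj => eq_zero_of_mem_gr (by omega) hs
  have hgs : ∀ W hW j, ∀ s ∈ gr EB F E j W,
      g.app W hW s = s + (x.app W hW s + w.app W hW s) := by
    intro W hW j s hs
    have h := (hg.2 W hW).2.2.2.2 j s hs
    -- Only two summands survive, since the degree of a section is at most the rank.
    have hle : (⨆ k : ℕ, gr EB F E (j + 2 * (k + 1)) W) ≤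
        gr EB F E (j + 2) W ⊔ gr EB F E (j + 4) W := by
      refine iSup_le fun k => ?_
      match k with
      | 0 => exact le_sup_left
      | 1 => exact le_sup_right
      | k + 2 =>
        intro t ht
        rw [z ht (by omega)]
        exact zero_mem _
    obtain ⟨a, ha, b, hb, hab⟩ := Submodule.mem_sup.1 (hle h)
    have e : g.app W hW s = s + (a + b) := by rw [hab]; abel
    have ex : x.app W hW s = a := by
      rw [hx, component_app 2 g hW hs, e, map_add, map_add, proj_of_mem ha,
        proj_of_mem_ne (by omega) hs, proj_of_mem_ne (by omega) hb, zero_add, add_zero]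
    have ew : w.app W hW s = b := by
      rw [hw, component_app 4 g hW hs, e, map_add, map_add, proj_of_mem hb,
        proj_of_mem_ne (by omega) hs, proj_of_mem_ne (by omega) ha, zero_add, zero_add]
    rw [ex, ew, e]
  have hmul : ∀ W hW s t, x.app W hW (s * t) = x.app W hW s * t + s * x.app W hW t ∧
      w.app W hW (s * t) = w.app W hW s * t + x.app W hW s * x.app W hW t + s * w.app W hW t := by
    intro W hW s t
    induction s using Sec.induction with
    | hadd s s' h h' =>
      rw [add_mul, map_add, map_add, map_add, map_add, h.1, h.2, h'.1, h'.2]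
      constructor <;> noncomm_ring
    | hgr i s hs =>
      induction t using Sec.induction with
      | hadd t t' h h' =>
        rw [mul_add, map_add, map_add, map_add, map_add, h.1, h.2, h'.1, h'.2]
        constructor <;> noncomm_ring
      | hgr j t ht =>
        have e := (hg.2 W hW).2.1 s t
        have hst := mul_mem_gr rfl hs ht
        have xs := x2 W hW i s hs
        have xt := x2 W hW j t ht
        have ws := w4 W hW i s hs
        have wt := w4 W hW j t ht
        rw [hgs W hW _ _ hst, hgs W hW _ _ hs, hgs W hW _ _ ht] at e
        have z1 := z (mul_mem_gr rfl xs wt) (by omega)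
        have z2 := z (mul_mem_gr rfl ws xt) (by omega)
        have z3 := z (mul_mem_gr rfl ws wt) (by omega)
        -- Multiplicativity of `g`, to be compared in the degrees `i + j + 2` and `i + j + 4`.
        have e' : x.app W hW (s * t) + w.app W hW (s * t) =
            (x.app W hW s * t + s * x.app W hW t) +
            (w.app W hW s * t + x.app W hW s * x.app W hW t + s * w.app W hW t) := by
          simp only [mul_add, add_mul, z1, z2, z3] at e
          refine add_left_cancel (e.trans ?_)
          abel
        refine gr_inj (by omega : i + j + 2 ≠ i + j + 4) (x2 W hW _ _ hst) ?_ (w4 W hW _ _ hst) ?_ e'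
        · refine add_mem ?_ ?_
          · exact mul_mem_gr (by omega) xs ht
          · exact mul_mem_gr (by omega) hs xt
        · refine add_mem (add_mem ?_ ?_) ?_
          · exact mul_mem_gr (by omega) ws ht
          · exact mul_mem_gr (by omega) xs xt
          · exact mul_mem_gr (by omega) hs wt
  refine ⟨x, fun W hW => ⟨fun s t => (hmul W hW s t).1, x2 W hW⟩, w - (1 / 2 : ℂ) • (x * x),
    fun W hW => ⟨fun s t => ?_, fun j s hs => ?_⟩, ?_⟩
  · simp only [ShEnd.sub_app, ShEnd.smul_app, ShEnd.mul_app, (hmul W hW _ _).1, (hmul W hW _ _).2,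
      map_add, sub_mul, mul_sub, smul_mul_assoc, mul_smul_comm]
    module
  · exact sub_mem (w4 W hW j s hs)
      (Submodule.smul_mem _ _ (x2 W hW _ _ (x2 W hW j s hs)))
  · rw [exp24, add_assoc, sub_add_cancel]
    refine ShEnd.ext fun W hW s => ?_
    induction s using Sec.induction with
    | hadd s t h h' => rw [map_add, map_add, h, h']
    | hgr j s hs =>
      rw [hgs W hW j s hs, ← add_assoc]
      rfl

end SheafGrading

/-! ### Gluing of derivations -/

section Gluing

variable {EB : Type*} [NormedAddCommGroup EB] [NormedSpace ℂ EB]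
  {M : Type*} [TopologicalSpace M] [ChartedSpace EB M]
  {F : Type*} [NormedAddCommGroup F] [NormedSpace ℂ F]
  {E : M → Type*} [∀ x, AddCommGroup (E x)] [∀ x, Module ℂ (E x)]
  [∀ x, TopologicalSpace (E x)] [TopologicalSpace (TotalSpace F E)] [FiberBundle F E]

theorem ShEnd.app_res {U : Opens M} (f : ShEnd EB F E U) {W W' : Opens M} (hW : W ≤ U)
    (h : W' ≤ W) (s : Sec EB F E W) :
    res EB F E h (f.app W hW s) = f.app W' (h.trans hW) (res EB F E h s) :=
  f.2 ⟨W, hW⟩ ⟨W', h.trans hW⟩ h s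

/-- A family of endomorphisms over an open cover that agree on overlaps determines, for every
section `s`, a section that near each point is the image of `s` under the members of the family. -/
theorem exists_glued_section {κ : Type*} {U : κ → Opens M} (hU : ∀ x : M, ∃ a, x ∈ U a)
    (f : ∀ a, ShEnd EB F E (U a))
    (hf : ∀ a b W (ha : W ≤ U a) (hb : W ≤ U b) s, (f a).app W ha s = (f b).app W hb s)
    (W : Opens M) (s : Sec EB F E W) :
    ∃ t : Sec EB F E W, ∀ a (W' : Opens M) (h : W' ≤ W) (ha : W' ≤ U a),
      res EB F E h t = (f a).app W' ha (res EB F E h s) := by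
  choose c hc using hU
  let t : RoughSections E W := fun x =>
    ((f (c x)).app (W ⊓ U (c x)) inf_le_right (res EB F E inf_le_left s)).1 ⟨x.1, x.2, hc x⟩
  have ht : ∀ a (W' : Opens M) (h : W' ≤ W) (ha : W' ≤ U a),
      roughRes E h t = ((f a).app W' ha (res EB F E h s)).1 := by
    intro a W' h ha
    funext x
    have e1 := (f (c x)).app_res inf_le_right
      (inf_le_inf_right (U (c x)) h) (res EB F E inf_le_left s)
    have e2 := (f a).app_res ha (inf_le_left : W' ⊓ U (c x) ≤ W') (res EB F E h s)
    rw [hf (c x) a (W' ⊓ U (c x)) inf_le_right (inf_le_left.trans ha)] at e1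
    exact congrArg (fun r => r.1 ⟨x.1, x.2, hc x⟩) (e1.trans e2.symm)
  refine ⟨⟨t, fun x => ?_⟩, fun a W' h ha => Subtype.ext (ht a W' h ha)⟩
  obtain ⟨W', h, hx, hW'⟩ := ((f (c x)).app (W ⊓ U (c x)) inf_le_right
    (res EB F E inf_le_left s)).2 ⟨x.1, x.2, hc x⟩
  refine ⟨W', h.trans inf_le_left, hx, ?_⟩
  rw [← ht (c x) (W ⊓ U (c x)) inf_le_left inf_le_right] at hW'
  exact hW'

theorem Sec.ext_cover {κ : Type*} {U : κ → Opens M} (hU : ∀ x : M, ∃ a, x ∈ U a) {W : Opens M}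
    {s t : Sec EB F E W}
    (h : ∀ a, res EB F E (inf_le_left : W ⊓ U a ≤ W) s = res EB F E inf_le_left t) : s = t :=
  Sec.ext fun x => by
    obtain ⟨a, ha⟩ := hU x
    exact congrArg (fun r => r.1 ⟨x.1, x.2, ha⟩) (h a)

/-- Derivations of degree `k` over an open cover that agree on overlaps come from a global one. -/
theorem exists_glued_Der {κ : Type*} {U : κ → Opens M} (hU : ∀ x : M, ∃ a, x ∈ U a) {k : ℕ}
    (f : ∀ a, ShEnd EB F E (U a)) (hk : ∀ a, f a ∈ Der EB F E k (U a))
    (hf : ∀ a b W (ha : W ≤ U a) (hb : W ≤ U b) s, (f a).app W ha s = (f b).app W hb s) :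
    ∃ g ∈ Der EB F E k (⊤ : Opens M), ∀ a, resEnd EB F E le_top g = f a := by
  choose t ht using exists_glued_section hU f hf
  have ht' : ∀ W s a, res EB F E inf_le_left (t W s) =
      (f a).app (W ⊓ U a) inf_le_right (res EB F E inf_le_left s) :=
    fun W s a => ht W s a _ inf_le_left inf_le_right
  let g : ShEnd EB F E (⊤ : Opens M) := ⟨fun W =>
    { toFun := t W.1
      map_add' := fun s s' => Sec.ext_cover hU fun a => by
        rw [ht', map_add, map_add, map_add, ht', ht']
      map_smul' := fun r s => Sec.ext_cover hU fun a => by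
        rw [ht', map_smul, map_smul, RingHom.id_apply, map_smul, ht'] },
    fun W W' h s => Sec.ext_cover hU fun a => by
      refine Eq.trans ?_ (ht' W'.1 _ a).symm
      exact ht W.1 s a (W'.1 ⊓ U a) (inf_le_left.trans h) inf_le_right⟩
  refine ⟨g, fun W _ => ⟨fun s s' => Sec.ext_cover hU fun a => ?_, fun j s hs x => ?_⟩,
    fun a => ShEnd.ext fun W hW s => ?_⟩
  · change res EB F E _ (t W (s * s')) = res EB F E _ (t W s * s' + s * t W s')
    rw [ht', map_mul (res EB F E _), (hk a _ _).1, map_add (res EB F E _), map_mul (res EB F E _),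
      map_mul (res EB F E _), ht', ht']
  · obtain ⟨a, ha⟩ := hU x
    have h := (hk a (W ⊓ U a) inf_le_right).2 j (res EB F E inf_le_left s)
      (fun y => hs ⟨y.1, y.2.1⟩) ⟨x.1, x.2, ha⟩
    rw [← ht'] at h
    exact h
  · exact ht W s a W le_rfl hW

end Gluing

/-! ### Čech cochains with values in derivations -/

section CechDerivations

variable {EB : Type*} [NormedAddCommGroup EB] [NormedSpace ℂ EB]
  {M : Type*} [TopologicalSpace M] [ChartedSpace EB M]
  {F : Type*} [NormedAddCommGroup F] [NormedSpace ℂ F]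
  {E : M → Type*} [∀ x, AddCommGroup (E x)] [∀ x, Module ℂ (E x)]
  [∀ x, TopologicalSpace (E x)] [TopologicalSpace (TotalSpace F E)] [FiberBundle F E]
  {J ι : Type*} [Preorder J] [IsDirectedOrder J] [Nonempty J] (𝔘 : CoverSystem M J ι)

theorem exists_refine_eq {q : ℕ} {j : J} {f g : CoverCochain EB F E 𝔘 q j}
    (h : ofCover EB F E 𝔘 q j f = ofCover EB F E 𝔘 q j g) :
    ∃ (k : J) (hk : j ≤ k), refine EB F E 𝔘 q j k hk f = refine EB F E 𝔘 q j k hk g := by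
  obtain ⟨k, hk, _, e⟩ := Quotient.exact h
  exact ⟨k, hk, e⟩

theorem pull_pull {p q r : ℕ} (a : Fin (p + 1) → Fin (r + 1)) (b : Fin (q + 1) → Fin (p + 1))
    (x : Cochain EB F E 𝔘 q) :
    pull EB F E 𝔘 a (pull EB F E 𝔘 b x) = pull EB F E 𝔘 (a ∘ b) x := by
  obtain ⟨j, f, rfl⟩ := exists_ofCover EB F E 𝔘 x
  rfl

theorem d0_apply (v : Cochain EB F E 𝔘 0) :
    d0 EB F E 𝔘 v = pull EB F E 𝔘 ![0] v - pull EB F E 𝔘 ![1] v := rfl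

theorem d1_apply (u : Cochain EB F E 𝔘 1) :
    d1 EB F E 𝔘 u = pull EB F E 𝔘 ![0, 1] u + pull EB F E 𝔘 ![1, 2] u - pull EB F E 𝔘 ![0, 2] u :=
  rfl

/-- On triples, the first and second vertex of the edge `(a, b)` are `a` and `b`. -/
theorem pull_edge_vertex (a b : Fin 3) (v : Cochain EB F E 𝔘 0) :
    pull EB F E 𝔘 (p := 2) ![a, b] (pull EB F E 𝔘 (p := 1) ![0] v) = pull EB F E 𝔘 ![a] v ∧
    pull EB F E 𝔘 (p := 2) ![a, b] (pull EB F E 𝔘 (p := 1) ![1] v) = pull EB F E 𝔘 ![b] v := by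
  have h0 : ![a, b] ∘ ![(0 : Fin 2)] = ![a] := funext fun i => by fin_cases i; rfl
  have h1 : ![a, b] ∘ ![(1 : Fin 2)] = ![b] := funext fun i => by fin_cases i; rfl
  rw [pull_pull, pull_pull, h0, h1]
  exact ⟨rfl, rfl⟩

theorem d1_d0 (v : Cochain EB F E 𝔘 0) : d1 EB F E 𝔘 (d0 EB F E 𝔘 v) = 0 := by
  simp only [d1_apply, d0_apply, map_sub, (pull_edge_vertex 𝔘 _ _ v).1,
    (pull_edge_vertex 𝔘 _ _ v).2]
  abel

theorem pull_mem_derCochain {p q k : ℕ} (a : Fin (q + 1) → Fin (p + 1)) {x : Cochain EB F E 𝔘 q}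
    (hx : x ∈ derCochain EB F E 𝔘 q k) : pull EB F E 𝔘 a x ∈ derCochain EB F E 𝔘 p k := by
  obtain ⟨j, f, hf, rfl⟩ := hx
  exact ⟨j, coverPull EB F E 𝔘 a j f, fun s => resEnd_Der EB F E k (𝔘.inter_comp j a s) (hf _), rfl⟩

theorem d0_mem_derCochain {k : ℕ} {v : Cochain EB F E 𝔘 0} (hv : v ∈ derCochain EB F E 𝔘 0 k) :
    d0 EB F E 𝔘 v ∈ derCochain EB F E 𝔘 1 k :=
  sub_mem (pull_mem_derCochain 𝔘 _ hv) (pull_mem_derCochain 𝔘 _ hv)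

theorem exists_common_cover {q k l : ℕ} {x y : Cochain EB F E 𝔘 q}
    (hx : x ∈ derCochain EB F E 𝔘 q k) (hy : y ∈ derCochain EB F E 𝔘 q l) :
    ∃ (j : J) (f g : CoverCochain EB F E 𝔘 q j), (∀ s, f s ∈ Der EB F E k (𝔘.inter j s)) ∧
      (∀ s, g s ∈ Der EB F E l (𝔘.inter j s)) ∧
      x = ofCover EB F E 𝔘 q j f ∧ y = ofCover EB F E 𝔘 q j g := by
  obtain ⟨i, f, hf, rfl⟩ := hx
  obtain ⟨j, g, hg, rfl⟩ := hy
  obtain ⟨m, h1, h2⟩ := exists_ge_ge i j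
  exact ⟨m, refine EB F E 𝔘 q i m h1 f, refine EB F E 𝔘 q j m h2 g,
    fun s => resEnd_Der EB F E k (𝔘.inter_anti h1 s) (hf s),
    fun s => resEnd_Der EB F E l (𝔘.inter_anti h2 s) (hg s),
    (ofCover_refine EB F E 𝔘 q h1 f).symm, (ofCover_refine EB F E 𝔘 q h2 g).symm⟩

theorem map_lie_ofCover {q : ℕ} {j : J} (f g : CoverCochain EB F E 𝔘 q j) :
    ofCover EB F E 𝔘 q j (fun s => ⁅f s, g s⁆) =
      ⁅ofCover EB F E 𝔘 q j f, ofCover EB F E 𝔘 q j g⁆ := by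
  rw [Ring.lie_def, ← map_mul, ← map_mul, ← map_sub]
  rfl

theorem lie_mem_derCochain {q k l m : ℕ} (h : k + l = m) {x y : Cochain EB F E 𝔘 q}
    (hx : x ∈ derCochain EB F E 𝔘 q k) (hy : y ∈ derCochain EB F E 𝔘 q l) :
    ⁅x, y⁆ ∈ derCochain EB F E 𝔘 q m := by
  subst h
  obtain ⟨j, f, g, hf, hg, rfl, rfl⟩ := exists_common_cover 𝔘 hx hy
  exact ⟨j, fun s => ⁅f s, g s⁆, fun s => lie_mem_Der (hf s) (hg s), (map_lie_ofCover 𝔘 f g).symm⟩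

theorem half_lie_mem_derCochain {q : ℕ} {x y : Cochain EB F E 𝔘 q}
    (hx : x ∈ derCochain EB F E 𝔘 q 2) (hy : y ∈ derCochain EB F E 𝔘 q 2) :
    (1 / 2 : ℂ) • ⁅x, y⁆ ∈ derCochain EB F E 𝔘 q 4 := by
  have h := lie_mem_derCochain 𝔘 (rfl : 2 + 2 = 4) hx hy
  exact Submodule.smul_mem _ _ h

theorem FF_mem_derCochain {v : Cochain EB F E 𝔘 0} (hv : v ∈ derCochain EB F E 𝔘 0 2)
    {u : Cochain EB F E 𝔘 1} (hu : u ∈ derCochain EB F E 𝔘 1 2) :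
    FF 𝔘 v u ∈ derCochain EB F E 𝔘 1 4 := by
  have h0 := pull_mem_derCochain 𝔘 (p := 1) ![0] hv
  have h1 := pull_mem_derCochain 𝔘 (p := 1) ![1] hv
  have h2 := lie_mem_derCochain 𝔘 (rfl : 2 + 2 = 4) (add_mem h0 h1) hu
  have h3 := lie_mem_derCochain 𝔘 (rfl : 2 + 2 = 4) h0 h1
  exact Submodule.smul_mem _ _ (sub_mem h2 h3)

/-- A `0`-cocycle of derivations glues to a global derivation. -/
theorem eq_zero_of_d0_eq_zero {k : ℕ} (hH0 : Der EB F E k (⊤ : Opens M) = ⊥)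
    {v : Cochain EB F E 𝔘 0} (hv : v ∈ derCochain EB F E 𝔘 0 k) (h : d0 EB F E 𝔘 v = 0) : v = 0 := by
  obtain ⟨i, f₀, hf₀, rfl⟩ := hv
  rw [d0_apply, pull_ofCover, pull_ofCover] at h
  obtain ⟨j, hj, e⟩ := exists_refine_eq 𝔘 (sub_eq_zero.1 h)
  rw [← ofCover_refine EB F E 𝔘 0 hj f₀]
  set f := refine EB F E 𝔘 0 i j hj f₀
  have hf : ∀ s, f s ∈ Der EB F E k (𝔘.inter j s) := fun s => 
    resEnd_Der EB F E k (𝔘.inter_anti hj s) (hf₀ s)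
  have e' : coverPull EB F E 𝔘 (p := 1) ![0] j f = coverPull EB F E 𝔘 (p := 1) ![1] j f := e
  have hU : ∀ x : M, ∃ s : Fin 1 → ι, x ∈ 𝔘.inter j s := by
    intro x
    have hx : x ∈ ⨆ a, 𝔘.cover j a := by
      rw [𝔘.covers j]
      trivial
    obtain ⟨a, ha⟩ := Opens.mem_iSup.1 hx
    exact ⟨fun _ => a, (le_iInf fun _ => le_rfl : 𝔘.cover j a ≤ 𝔘.inter j fun _ : Fin 1 => a) ha⟩
  -- The equation `e'` at `r = (s, t)` is agreement of `f s` and `f t` on the overlap; `s` and `t` are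
  -- kept as variables because `r ∘ ![0]` is not definitionally `s`.
  have hcompat : ∀ (r : Fin 2 → ι) (s t : Fin 1 → ι), r ∘ ![0] = s → r ∘ ![1] = t →
      ∀ W (hs : W ≤ 𝔘.inter j s) (ht : W ≤ 𝔘.inter j t) x,
        (f s).app W hs x = (f t).app W ht x := by
    rintro r _ _ rfl rfl W hs ht x
    have hr : W ≤ 𝔘.inter j r := by
      refine le_iInf fun a => ?_
      fin_cases a
      · exact hs.trans (iInf_le _ 0)
      · exact ht.trans (iInf_le _ 0)
    exact congrArg (fun g => ShEnd.app g W hr x) (congrFun e' r)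
  obtain ⟨g, hg, hgf⟩ := exists_glued_Der hU f hf fun s t =>
    hcompat ![s 0, t 0] s t (funext fun a => by fin_cases a; rfl)
      (funext fun a => by fin_cases a; rfl)
  rw [hH0, Submodule.mem_bot] at hg
  have : f = 0 := funext fun s => by rw [← hgf s, hg, map_zero]; rfl
  rw [this, map_zero]

theorem FF_eq (v : Cochain EB F E 𝔘 0) (u : Cochain EB F E 𝔘 1) :
    FF 𝔘 v u = (1 / 2 : ℂ) • (⁅pull EB F E 𝔘 (p := 1) ![0] v + pull EB F E 𝔘 (p := 1) ![1] v, u⁆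
    - ⁅pull EB F E 𝔘 (p := 1) ![0] v, pull EB F E 𝔘 (p := 1) ![1] v⁆) := rfl

theorem FF_zero (u : Cochain EB F E 𝔘 1) : FF 𝔘 0 u = 0 := by
  simp [FF_eq, Ring.lie_def]

/-- The cocycle rule of `F`, up to the coboundary of `½ [w, v]`. -/
theorem FF_add (v w : Cochain EB F E 𝔘 0) (u : Cochain EB F E 𝔘 1) :
    FF 𝔘 v u + FF 𝔘 w (u + d0 EB F E 𝔘 v) =
      FF 𝔘 (v + w) u + d0 EB F E 𝔘 ((1 / 2 : ℂ) • ⁅w, v⁆) := by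
  simp only [FF_eq, d0_apply, Ring.lie_def, map_smul, map_sub, map_mul, map_add]
  simp only [mul_add, add_mul, mul_sub, sub_mul]
  module

end CechDerivations

/-! ### Cocycles of derivations and strongly compatible maps -/

section CechExp

variable {EB : Type*} [NormedAddCommGroup EB] [NormedSpace ℂ EB]
  {M : Type*} [TopologicalSpace M] [ChartedSpace EB M]
  {F : Type*} [NormedAddCommGroup F] [NormedSpace ℂ F]
  {E : M → Type*} [∀ x, AddCommGroup (E x)] [∀ x, Module ℂ (E x)]
  [∀ x, TopologicalSpace (E x)] [TopologicalSpace (TotalSpace F E)] [FiberBundle F E]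
  {J ι : Type*} [Preorder J] [IsDirectedOrder J] [Nonempty J] (𝔘 : CoverSystem M J ι)

theorem act_one {q : ℕ} (x : Cochain EB F E 𝔘 q) : act 𝔘 (1 : AutE EB F E) x = x := by
  rw [act_apply, inv_one, lamEnd_one, map_one, one_mul, mul_one]

theorem act_act_inv {q : ℕ} (φ : AutE EB F E) (x : Cochain EB F E 𝔘 q) :
    act 𝔘 φ (act 𝔘 φ⁻¹ x) = x := by
  simpa only [inv_inv] using act_inv_act 𝔘 φ⁻¹ x

variable {𝔘}

theorem mem_Zt_of_d1_eq {x y : Cochain EB F E 𝔘 1} (hx : x ∈ Z1 EB F E 𝔘 2)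
    (hy : y ∈ derCochain EB F E 𝔘 1 4) (h : d1 EB F E 𝔘 y = -cc 𝔘 x) : x ∈ Zt EB F E 𝔘 :=
  ⟨hx, -y, neg_mem hy, by rw [map_neg, h, neg_neg]⟩

theorem add_d0_mem_Z1 {u : Cochain EB F E 𝔘 1} (hu : u ∈ Z1 EB F E 𝔘 2) {v : Cochain EB F E 𝔘 0}
    (hv : v ∈ derCochain EB F E 𝔘 0 2) : u + d0 EB F E 𝔘 v ∈ Z1 EB F E 𝔘 2 := by
  refine ⟨add_mem hu.1 (d0_mem_derCochain 𝔘 hv), LinearMap.mem_ker.2 ?_⟩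
  rw [map_add, LinearMap.mem_ker.1 hu.2, d1_d0, add_zero]

variable {D : AutE EB F E → Cochain EB F E 𝔘 0 → Cochain EB F E 𝔘 1 → Cochain EB F E 𝔘 1}

theorem D_add_mem_Z1 (hD : StronglyCompatible EB F E 𝔘 D) {x y : Cochain EB F E 𝔘 1}
    (hx : x ∈ Zt EB F E 𝔘) (hy : y ∈ derCochain EB F E 𝔘 1 4) (h : d1 EB F E 𝔘 y = -cc 𝔘 x) :
    D 1 0 x + y ∈ Z1 EB F E 𝔘 4 := by
  refine ⟨add_mem (hD.mem 1 0 (zero_mem _) x hx) hy, LinearMap.mem_ker.2 ?_⟩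
  rw [map_add, hD.coboundary 1 0 (zero_mem _) x hx, h, add_neg_cancel]

/-- The values of `D(Id, 0, ·)` at cohomologous `x` and `x + dv` differ by `F(v, x)`, up to
coboundaries. -/
theorem D_add_d0 (hD : StronglyCompatible EB F E 𝔘 D) {x : Cochain EB F E 𝔘 1}
    (hx : x ∈ Zt EB F E 𝔘) {v : Cochain EB F E 𝔘 0} (hv : v ∈ derCochain EB F E 𝔘 0 2) :
    D 1 0 (x + d0 EB F E 𝔘 v) + FF 𝔘 v x - D 1 0 x ∈ B1 EB F E 𝔘 4 := by
  have h1 := hD.compat 1 v hv x hx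
  have h2 := hD.strong 1 v hv x hx
  rwa [h1, act_one, act_one] at h2

/-! ### Exponentials of cochains -/

variable (𝔘)

variable (EB F E) in
/-- The projection onto `𝒪_{Λ^j E}` as a constant cochain. -/
def cochainProj (q j : ℕ) : Cochain EB F E 𝔘 q := const EB F E 𝔘 q (projEnd EB F E j)

variable [VectorBundle ℂ F E]

theorem finiteDimensional_of_rank (hrk : Module.finrank ℂ F = 4 ∨ Module.finrank ℂ F = 5) :
    FiniteDimensional ℂ F :=
  Module.finite_of_finrank_pos (by omega)

variable (hrk : Module.finrank ℂ F = 4 ∨ Module.finrank ℂ F = 5)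

include hrk

theorem isGrading_cochainProj (q : ℕ) :
    IsGrading (Module.finrank ℂ F) (cochainProj EB F E 𝔘 q) := by
  have := finiteDimensional_of_rank hrk
  exact (isGrading_localProj EB F E ⊤).map (const EB F E 𝔘 q).toRingHom

theorem derCochain_le_raising (q k : ℕ) :
    derCochain EB F E 𝔘 q k ≤ raising (cochainProj EB F E 𝔘 q) k := by
  have := finiteDimensional_of_rank hrk
  rintro _ ⟨j, f, hf, rfl⟩ i
  rw [cochainProj, cochainProj, const_eq EB F E 𝔘 q _ j, const_eq EB F E 𝔘 q _ j, ← map_mul,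
    ← map_mul]
  exact congrArg (ofCover EB F E 𝔘 q j) (funext fun s => Der_le_raising k _ (hf s) i)

variable {𝔘} {q : ℕ} {x y x' y' : Cochain EB F E 𝔘 q}

theorem expo_add (hx : x ∈ derCochain EB F E 𝔘 q 2) (hy : y ∈ derCochain EB F E 𝔘 q 4) :
    expo 𝔘 (x + y) = exp24 x y :=
  sum_range_exp (isGrading_cochainProj 𝔘 hrk q) (by omega) (by omega)
    (derCochain_le_raising 𝔘 hrk q 2 hx) (derCochain_le_raising 𝔘 hrk q 4 hy)

theorem expo_eq (hx : x ∈ derCochain EB F E 𝔘 q 2) : expo 𝔘 x = exp24 x 0 := by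
  rw [← expo_add hrk hx (zero_mem _), add_zero]

theorem cochain_exp24_mul (hx : x ∈ derCochain EB F E 𝔘 q 2) (hy : y ∈ derCochain EB F E 𝔘 q 4)
    (hx' : x' ∈ derCochain EB F E 𝔘 q 2) (hy' : y' ∈ derCochain EB F E 𝔘 q 4) :
    exp24 x y * exp24 x' y' = exp24 (x + x') (y + y' + (1 / 2 : ℂ) • ⁅x, x'⁆) :=
  exp24_mul (isGrading_cochainProj 𝔘 hrk q) (by omega) (derCochain_le_raising 𝔘 hrk q 2 hx)
    (derCochain_le_raising 𝔘 hrk q 4 hy) (derCochain_le_raising 𝔘 hrk q 2 hx')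
    (derCochain_le_raising 𝔘 hrk q 4 hy')

theorem cochain_exp24_inj (hx : x ∈ derCochain EB F E 𝔘 q 2) (hy : y ∈ derCochain EB F E 𝔘 q 4)
    (hx' : x' ∈ derCochain EB F E 𝔘 q 2) (hy' : y' ∈ derCochain EB F E 𝔘 q 4) :
    exp24 x y = exp24 x' y' ↔ x = x' ∧ y = y' :=
  exp24_inj (isGrading_cochainProj 𝔘 hrk q) (derCochain_le_raising 𝔘 hrk q 2 hx)
    (derCochain_le_raising 𝔘 hrk q 4 hy) (derCochain_le_raising 𝔘 hrk q 2 hx')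
    (derCochain_le_raising 𝔘 hrk q 4 hy')

theorem exp24_mem_geCochain (hx : x ∈ derCochain EB F E 𝔘 q 2)
    (hy : y ∈ derCochain EB F E 𝔘 q 4) : exp24 x y ∈ geCochain EB F E 𝔘 q := by
  have := finiteDimensional_of_rank hrk
  obtain ⟨j, f, g, hf, hg, rfl, rfl⟩ := exists_common_cover 𝔘 hx hy
  exact ⟨j, fun s => exp24 (f s) (g s), fun s => exp24_mem_GE (by omega) (hf s) (hg s),
    (map_exp24 (ofCover EB F E 𝔘 q j) f g).symm⟩

theorem exists_exp24_of_mem_geCochain {g : Cochain EB F E 𝔘 q}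
    (hg : g ∈ geCochain EB F E 𝔘 q) :
    ∃ x ∈ derCochain EB F E 𝔘 q 2, ∃ y ∈ derCochain EB F E 𝔘 q 4, g = exp24 x y := by
  have := finiteDimensional_of_rank hrk
  obtain ⟨j, f, hf, rfl⟩ := hg
  choose a ha b hb e using fun s => exists_exp24_of_mem_GE (by omega) (hf s)
  refine ⟨_, ⟨j, a, ha, rfl⟩, _, ⟨j, b, hb, rfl⟩, ?_⟩
  rw [← map_exp24]
  exact congrArg _ (funext e)

/-! ### The obstruction class and cocycles with values in `G_E` -/

/-- For a cocycle `u`, `(c_u)_{ijk} = ½ [u_{ij}, u_{jk}]`. -/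
theorem cc_eq {u : Cochain EB F E 𝔘 1} (hu : u ∈ Z1 EB F E 𝔘 2) :
    cc 𝔘 u = (1 / 2 : ℂ) • ⁅pull EB F E 𝔘 (p := 2) ![0, 1] u, pull EB F E 𝔘 (p := 2) ![1, 2] u⁆ := by
  have hd : d1 EB F E 𝔘 u = 0 := hu.2
  rw [d1_apply, sub_eq_zero] at hd
  have ha := pull_mem_derCochain 𝔘 (p := 2) ![0, 1] hu.1
  have hb := pull_mem_derCochain 𝔘 (p := 2) ![1, 2] hu.1
  rw [cc, dG, expo_eq hrk hu.1, map_exp24, map_exp24, map_exp24, ← hd, map_zero, map_zero, map_zero]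
  set a := pull EB F E 𝔘 (p := 2) ![0, 1] u
  set b := pull EB F E 𝔘 (p := 2) ![1, 2] u
  have hP := isGrading_cochainProj (EB := EB) (E := E) 𝔘 hrk 2
  have r := derCochain_le_raising (EB := EB) (E := E) 𝔘 hrk 2 2
  have hab := half_lie_mem_derCochain 𝔘 ha hb
  have hinv : Ring.inverse (exp24 (a + b) 0) = exp24 (-(a + b)) 0 := by
    have h1 := exp24_mul_neg hP (by omega) (r (add_mem ha hb)) (zero_mem _)
    have h2 := exp24_neg_mul hP (by omega) (r (add_mem ha hb)) (zero_mem _)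
    rw [neg_zero] at h1 h2
    exact Ring.inverse_unit ⟨_, _, h1, h2⟩
  have hz : (0 : Cochain EB F E 𝔘 2) ∈ derCochain EB F E 𝔘 2 4 := zero_mem _
  rw [hinv, cochain_exp24_mul hrk ha hz hb hz,
    cochain_exp24_mul hrk (add_mem ha hb) (add_mem (add_mem hz hz) hab)
      (neg_mem (add_mem ha hb)) hz, add_neg_cancel]
  have e : (0 + 0 + (1 / 2 : ℂ) • ⁅a, b⁆ + 0 + (1 / 2 : ℂ) • ⁅a + b, -(a + b)⁆) =
      (1 / 2 : ℂ) • ⁅a, b⁆ := by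
    rw [Ring.lie_def (a + b), mul_neg, neg_mul, sub_self]
    simp
  rw [e]
  refine (component_four_exp24 hP (zero_mem _) (derCochain_le_raising 𝔘 hrk 2 4 hab)).trans ?_
  rw [mul_zero, smul_zero, add_zero]

/-- The cocycle condition for `exp(x + y)`, split into degrees `2` and `4`. -/
theorem exp24_mem_Z1G_iff {x y : Cochain EB F E 𝔘 1} (hx : x ∈ derCochain EB F E 𝔘 1 2)
    (hy : y ∈ derCochain EB F E 𝔘 1 4) :
    exp24 x y ∈ Z1G EB F E 𝔘 ↔ x ∈ Z1 EB F E 𝔘 2 ∧ d1 EB F E 𝔘 y = -cc 𝔘 x := by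
  have p2 := fun a : Fin 2 → Fin 3 => pull_mem_derCochain 𝔘 (p := 2) a hx
  have p4 := fun a : Fin 2 → Fin 3 => pull_mem_derCochain 𝔘 (p := 2) a hy
  have h1 : exp24 x y ∈ Z1G EB F E 𝔘 ↔
      pull EB F E 𝔘 (p := 2) ![0, 1] (exp24 x y) * pull EB F E 𝔘 ![1, 2] (exp24 x y) =
        pull EB F E 𝔘 ![0, 2] (exp24 x y) :=
    ⟨fun h => h.2, fun h => ⟨exp24_mem_geCochain hrk hx hy, h⟩⟩
  rw [h1, map_exp24, map_exp24, map_exp24, cochain_exp24_mul hrk (p2 _) (p4 _) (p2 _) (p4 _),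
    cochain_exp24_inj hrk (add_mem (p2 _) (p2 _))
      (add_mem (add_mem (p4 _) (p4 _)) (half_lie_mem_derCochain 𝔘 (p2 _) (p2 _))) (p2 _) (p4 _)]
  have h2 : x ∈ Z1 EB F E 𝔘 2 ↔ pull EB F E 𝔘 (p := 2) ![0, 1] x + pull EB F E 𝔘 ![1, 2] x =
      pull EB F E 𝔘 ![0, 2] x := by
    rw [← sub_eq_zero, ← d1_apply]
    exact ⟨fun h => h.2, fun h => ⟨hx, h⟩⟩
  rw [← h2]
  refine and_congr_right fun hz => ?_
  rw [cc_eq hrk hz, d1_apply, sub_eq_iff_eq_add', ← sub_eq_add_neg, eq_sub_iff_add_eq]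

/-- Conjugation of `exp(x + y)` by `h = exp(v + w)`, split into degrees `2` and `4`. The brackets of
the Baker–Campbell–Hausdorff formula combine to `F(v, x)`. -/
theorem cohomologous_iff {x y x' y' : Cochain EB F E 𝔘 1}
    (hx : x ∈ derCochain EB F E 𝔘 1 2) (hy : y ∈ derCochain EB F E 𝔘 1 4)
    (hx' : x' ∈ derCochain EB F E 𝔘 1 2) (hy' : y' ∈ derCochain EB F E 𝔘 1 4)
    {g g' : Z1G EB F E 𝔘} (hg : g.1 = exp24 x y) (hg' : g'.1 = exp24 x' y') :
    cohomologous EB F E 𝔘 g g' ↔ ∃ v ∈ derCochain EB F E 𝔘 0 2, ∃ w ∈ derCochain EB F E 𝔘 0 4,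
      x' = x + d0 EB F E 𝔘 v ∧ y' = y + d0 EB F E 𝔘 w + FF 𝔘 v x := by
  have key : ∀ v ∈ derCochain EB F E 𝔘 0 2, ∀ w ∈ derCochain EB F E 𝔘 0 4,
      (g'.1 * pull EB F E 𝔘 ![1] (exp24 v w) = pull EB F E 𝔘 ![0] (exp24 v w) * g.1 ↔
        x' = x + d0 EB F E 𝔘 v ∧ y' = y + d0 EB F E 𝔘 w + FF 𝔘 v x) := by
    intro v hv w hw
    have v2 := fun a : Fin 1 → Fin 2 => pull_mem_derCochain 𝔘 (p := 1) a hv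
    have w4 := fun a : Fin 1 → Fin 2 => pull_mem_derCochain 𝔘 (p := 1) a hw
    rw [hg, hg', map_exp24, map_exp24, cochain_exp24_mul hrk hx' hy' (v2 _) (w4 _),
      cochain_exp24_mul hrk (v2 _) (w4 _) hx hy,
      cochain_exp24_inj hrk (add_mem hx' (v2 _))
        (add_mem (add_mem hy' (w4 _)) (half_lie_mem_derCochain 𝔘 hx' (v2 _)))
        (add_mem (v2 _) hx) (add_mem (add_mem (w4 _) hy) (half_lie_mem_derCochain 𝔘 (v2 _) hx)),
      d0_apply, d0_apply, FF_eq]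
    have h1 : x' + pull EB F E 𝔘 ![1] v = pull EB F E 𝔘 ![0] v + x ↔
        x' = x + (pull EB F E 𝔘 ![0] v - pull EB F E 𝔘 ![1] v) := by
      rw [← eq_sub_iff_add_eq, add_comm _ x, add_sub_assoc]
    rw [h1]
    refine and_congr_right fun e => ?_
    rw [add_assoc, ← eq_sub_iff_add_eq, e]
    refine Eq.congr_right ?_
    simp only [Ring.lie_def, mul_add, add_mul, mul_sub, sub_mul]
    module
  constructor
  · rintro ⟨h, hh, e⟩
    obtain ⟨v, hv, w, hw, rfl⟩ := exists_exp24_of_mem_geCochain hrk hh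
    exact ⟨v, hv, w, hw, (key v hv w hw).1 e⟩
  · rintro ⟨v, hv, w, hw, e⟩
    exact ⟨_, exp24_mem_geCochain hrk hv hw, (key v hv w hw).2 e⟩

/-! ### Existence of strongly compatible maps -/

/-- `F(v, u)` is a primitive of the difference between `c_u` and `c_{u + dv}`. -/
theorem cc_add_d0 {u : Cochain EB F E 𝔘 1} (hu : u ∈ Z1 EB F E 𝔘 2) {v : Cochain EB F E 𝔘 0}
    (hv : v ∈ derCochain EB F E 𝔘 0 2) :
    cc 𝔘 (u + d0 EB F E 𝔘 v) + d1 EB F E 𝔘 (FF 𝔘 v u) = cc 𝔘 u := by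
  have hd : d1 EB F E 𝔘 u = 0 := hu.2
  rw [d1_apply, sub_eq_zero] at hd
  rw [cc_eq hrk hu, cc_eq hrk (add_d0_mem_Z1 hu hv)]
  simp only [FF_eq, d1_apply, d0_apply, Ring.lie_def, map_smul, map_sub, map_mul, map_add,
    (pull_edge_vertex 𝔘 _ _ v).1, (pull_edge_vertex 𝔘 _ _ v).2, ← hd]
  simp only [mul_add, add_mul, mul_sub, sub_mul]
  module

theorem add_d0_mem_Zt {u : Cochain EB F E 𝔘 1} (hu : u ∈ Zt EB F E 𝔘) {v : Cochain EB F E 𝔘 0}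
    (hv : v ∈ derCochain EB F E 𝔘 0 2) : u + d0 EB F E 𝔘 v ∈ Zt EB F E 𝔘 := by
  refine ⟨add_d0_mem_Z1 hu.1 hv, ?_⟩
  rw [eq_sub_of_add_eq (cc_add_d0 hrk hu.1 hv)]
  exact sub_mem hu.2 ⟨_, FF_mem_derCochain 𝔘 hv hu.1.1, rfl⟩

variable (𝔘) in
/-- A choice `D₀` of primitives of `c_u` that transforms under `u ↦ u + dv` by `F(v, u)`, up to
coboundaries. In each class a representative `u₀` and a primitive of `c_{u₀}` are chosen. Since
`H⁰(M, Der_2(ΛE)) = 0`, the cochain `v` in `u = u₀ + dv` is unique, and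
`D₀(u) = D₀(u₀) - F(v, u₀)`. -/
theorem exists_primitive (hH0 : Der EB F E 2 (⊤ : Opens M) = ⊥) :
    ∃ D₀ : Cochain EB F E 𝔘 1 → Cochain EB F E 𝔘 1,
      (∀ u ∈ Zt EB F E 𝔘, D₀ u ∈ derCochain EB F E 𝔘 1 4 ∧ d1 EB F E 𝔘 (D₀ u) = cc 𝔘 u) ∧
      ∀ u ∈ Zt EB F E 𝔘, ∀ v ∈ derCochain EB F E 𝔘 0 2,
        D₀ (u + d0 EB F E 𝔘 v) + FF 𝔘 v u - D₀ u ∈ B1 EB F E 𝔘 4 := by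
  classical
  have hrep : ∀ c : ZtB EB F E 𝔘, ∃ u₀ : Zt EB F E 𝔘, ZtB.mk 𝔘 u₀ = c := Quotient.exists_rep
  choose rep hr using hrep
  choose b hb hbd using fun u : Zt EB F E 𝔘 => u.2.2
  have hv : ∀ u : Zt EB F E 𝔘, ∃ v ∈ derCochain EB F E 𝔘 0 2,
      d0 EB F E 𝔘 v = u.1 - (rep (ZtB.mk 𝔘 u)).1 :=
    fun u => Quotient.exact (hr (ZtB.mk 𝔘 u)).symm
  choose v hv hvd using hv
  let D (u : Zt EB F E 𝔘) : Cochain EB F E 𝔘 1 :=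
    b (rep (ZtB.mk 𝔘 u)) - FF 𝔘 (v u) (rep (ZtB.mk 𝔘 u)).1
  refine ⟨fun u => if h : u ∈ Zt EB F E 𝔘 then D ⟨u, h⟩ else 0, fun u hu => ?_, fun u hu w hw => ?_⟩
  · beta_reduce
    rw [dif_pos hu]
    set u₀ := rep (ZtB.mk 𝔘 ⟨u, hu⟩) with hu₀
    have e : u = u₀.1 + d0 EB F E 𝔘 (v ⟨u, hu⟩) := by rw [hvd, add_sub_cancel]
    refine ⟨sub_mem (hb _) (FF_mem_derCochain 𝔘 (hv _) u₀.2.1.1), ?_⟩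
    have h := cc_add_d0 hrk u₀.2.1 (hv ⟨u, hu⟩)
    rw [← e] at h
    rw [map_sub, hbd, ← hu₀, ← h, add_sub_cancel_right]
  · have hu' := add_d0_mem_Zt hrk hu hw
    beta_reduce
    rw [dif_pos hu, dif_pos hu']
    have ec : ZtB.mk 𝔘 ⟨_, hu'⟩ = ZtB.mk 𝔘 ⟨u, hu⟩ :=
      Quotient.sound ⟨w, hw, (add_sub_cancel_left _ _).symm⟩
    have e1 : d0 EB F E 𝔘 (v ⟨u, hu⟩) = u - (rep (ZtB.mk 𝔘 ⟨u, hu⟩)).1 := hvd _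
    have e2 : d0 EB F E 𝔘 (v ⟨_, hu'⟩) =
        u + d0 EB F E 𝔘 w - (rep (ZtB.mk 𝔘 ⟨_, hu'⟩)).1 := hvd _
    have hv1 := hv ⟨u, hu⟩
    have hv2 := hv ⟨_, hu'⟩
    change b (rep (ZtB.mk 𝔘 ⟨_, hu'⟩)) - FF 𝔘 (v ⟨_, hu'⟩) (rep (ZtB.mk 𝔘 ⟨_, hu'⟩)).1 + FF 𝔘 w u -
      (b (rep (ZtB.mk 𝔘 ⟨u, hu⟩)) - FF 𝔘 (v ⟨u, hu⟩) (rep (ZtB.mk 𝔘 ⟨u, hu⟩)).1) ∈ _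
    rw [ec] at e2 ⊢
    set u₀ := rep (ZtB.mk 𝔘 ⟨u, hu⟩)
    set v₁ := v ⟨u, hu⟩
    set v₂ := v ⟨_, hu'⟩
    -- The only use of the vanishing of global derivations: `v` depends additively on `u`.
    have ev : v₂ = v₁ + w := by
      refine sub_eq_zero.1 (eq_zero_of_d0_eq_zero 𝔘 hH0 (sub_mem hv2 (add_mem hv1 hw)) ?_)
      rw [map_sub, map_add, e1, e2]
      abel
    have eu : u = u₀.1 + d0 EB F E 𝔘 v₁ := by rw [e1, add_sub_cancel]
    have hF := FF_add 𝔘 v₁ w u₀.1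
    rw [← eu] at hF
    refine ⟨(1 / 2 : ℂ) • ⁅w, v₁⁆, half_lie_mem_derCochain 𝔘 hw hv1, ?_⟩
    rw [eq_sub_of_add_eq' hF.symm, ev]
    abel

variable (𝔘) in
/-- Once `D(Id, 0, ·)` is chosen, the compatibility condition determines `D(φ, v, u)` for all
`φ` and `v`. -/
theorem exists_stronglyCompatible (hH0 : Der EB F E 2 (⊤ : Opens M) = ⊥) :
    ∃ D, StronglyCompatible EB F E 𝔘 D := by
  obtain ⟨D₀, h1, h2⟩ := exists_primitive 𝔘 hrk hH0
  refine ⟨fun φ v u => act 𝔘 φ⁻¹ (D₀ (act 𝔘 φ u + d0 EB F E 𝔘 (act 𝔘 φ v)) +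
    FF 𝔘 (act 𝔘 φ v) (act 𝔘 φ u)), ?_⟩
  have e : ∀ u : Cochain EB F E 𝔘 1, act 𝔘 (1 : AutE EB F E)⁻¹
      (D₀ (act 𝔘 (1 : AutE EB F E) u + d0 EB F E 𝔘 (act 𝔘 (1 : AutE EB F E) 0)) +
        FF 𝔘 (act 𝔘 (1 : AutE EB F E) 0) (act 𝔘 (1 : AutE EB F E) u)) = D₀ u := by
    intro u
    rw [inv_one, act_one, act_one, act_one, map_zero, FF_zero, add_zero, add_zero]
  refine ⟨fun φ v hv u hu => ?_, fun φ v hv u hu => ?_, fun φ v hv u hu => ?_,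
    fun φ v hv u hu => ?_⟩
  all_goals
    have hu' := act_Zt 𝔘 φ hu
    have hv' := act_derCochain 𝔘 φ hv
    have hD := h1 _ (add_d0_mem_Zt hrk hu' hv')
  · exact act_derCochain 𝔘 _ (add_mem hD.1 (FF_mem_derCochain 𝔘 hv' hu'.1.1))
  · rw [d1_act, map_add, hD.2, cc_add_d0 hrk hu'.1 hv', ← act_cc, act_inv_act]
  · rw [e, act_act_inv]
  · rw [e, act_act_inv]
    exact h2 _ hu' _ hv'

/-! ### The classification of cocycles with values in `G_E` -/

variable (𝔘) in
theorem existsUnique_log {g : Cochain EB F E 𝔘 1} (hg : g ∈ Z1G EB F E 𝔘) :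
    ∃! u : Cochain EB F E 𝔘 1 × Cochain EB F E 𝔘 1,
      u.1 ∈ derCochain EB F E 𝔘 1 2 ∧ u.2 ∈ derCochain EB F E 𝔘 1 4 ∧ g = expo 𝔘 (u.1 + u.2) := by
  obtain ⟨x, hx, y, hy, e⟩ := exists_exp24_of_mem_geCochain hrk hg.1
  refine ⟨(x, y), ⟨hx, hy, by rw [e, expo_add hrk hx hy]⟩, ?_⟩
  rintro ⟨x', y'⟩ ⟨hx', hy', e'⟩
  rw [e, expo_add hrk hx' hy', cochain_exp24_inj hrk hx hy hx' hy'] at e'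
  exact Prod.ext e'.1.symm e'.2.symm

/-- With the logarithm `x + y` of a cocycle, the map is `exp(x + y) ↦ ([x], [D(Id, 0, x) + y])`.
Its fibres are exactly the classes of cohomologous cocycles, because the degree `4` term
`F(v, x)` of a conjugation is what `D(Id, 0, ·)` loses in passing from `x` to `x + dv`, up to
coboundaries. -/
theorem exists_classification (hD : StronglyCompatible EB F E 𝔘 D) :
    ∃ σ : H1G EB F E 𝔘 → ZtB EB F E 𝔘 × H1Der EB F E 𝔘 4,
      Function.Bijective σ ∧
      ∀ u₂ ∈ derCochain EB F E 𝔘 1 2, ∀ u₄ ∈ derCochain EB F E 𝔘 1 4,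
        ∀ hg : expo 𝔘 (u₂ + u₄) ∈ Z1G EB F E 𝔘,
        ∃ (h₂ : u₂ ∈ Zt EB F E 𝔘) (h₄ : D 1 0 u₂ + u₄ ∈ Z1 EB F E 𝔘 4),
          σ (H1G.mk 𝔘 ⟨_, hg⟩) = (ZtB.mk 𝔘 ⟨u₂, h₂⟩, Submodule.Quotient.mk ⟨_, h₄⟩) := by
  have hlog : ∀ g : Z1G EB F E 𝔘, ∃ x y, x ∈ derCochain EB F E 𝔘 1 2 ∧
      y ∈ derCochain EB F E 𝔘 1 4 ∧ g.1 = exp24 x y := by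
    intro g
    obtain ⟨x, hx, y, hy, e⟩ := exists_exp24_of_mem_geCochain hrk g.2.1
    exact ⟨x, y, hx, hy, e⟩
  choose x y hx hy e using hlog
  have hz := fun g => (exp24_mem_Z1G_iff hrk (hx g) (hy g)).1 (e g ▸ g.2)
  have hzt := fun g => mem_Zt_of_d1_eq (hz g).1 (hy g) (hz g).2
  have hz4 := fun g => D_add_mem_Z1 hD (hzt g) (hy g) (hz g).2
  let τ (g : Z1G EB F E 𝔘) : ZtB EB F E 𝔘 × H1Der EB F E 𝔘 4 :=
    (ZtB.mk 𝔘 ⟨x g, hzt g⟩, Submodule.Quotient.mk ⟨_, hz4 g⟩)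
  have hτ : ∀ g g', τ g' = τ g ↔ x g' - x g ∈ B1 EB F E 𝔘 2 ∧
      (D 1 0 (x g') + y g') - (D 1 0 (x g) + y g) ∈ B1 EB F E 𝔘 4 := by
    intro g g'
    rw [Prod.ext_iff]
    exact and_congr ⟨Quotient.exact, fun h => Quotient.sound h⟩ (Submodule.Quotient.eq _)
  have hco : ∀ g g', cohomologous EB F E 𝔘 g g' ↔ τ g' = τ g := by
    intro g g'
    rw [hτ, cohomologous_iff hrk (hx g) (hy g) (hx g') (hy g') (e g) (e g')]
    constructor
    · rintro ⟨v, hv, w, hw, e2, e4⟩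
      refine ⟨⟨v, hv, by rw [e2, add_sub_cancel_left]⟩, ?_⟩
      have h : D 1 0 (x g') + y g' - (D 1 0 (x g) + y g) =
          (D 1 0 (x g + d0 EB F E 𝔘 v) + FF 𝔘 v (x g) - D 1 0 (x g)) + d0 EB F E 𝔘 w := by
        rw [e2, e4]
        abel
      rw [h]
      exact add_mem (D_add_d0 hD (hzt g) hv) ⟨w, hw, rfl⟩
    · rintro ⟨⟨v, hv, e2⟩, h4⟩
      have e2' : x g' = x g + d0 EB F E 𝔘 v := by rw [e2, add_sub_cancel]
      have h := sub_mem h4 (D_add_d0 hD (hzt g) hv)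
      obtain ⟨w, hw, e4⟩ := h
      refine ⟨v, hv, w, hw, e2', ?_⟩
      rw [e4, e2']
      abel
  have hσ : ∀ u₂ ∈ derCochain EB F E 𝔘 1 2, ∀ u₄ ∈ derCochain EB F E 𝔘 1 4,
      ∀ g : Z1G EB F E 𝔘, g.1 = exp24 u₂ u₄ → x g = u₂ ∧ y g = u₄ := by
    intro u₂ h₂ u₄ h₄ g hg
    exact (cochain_exp24_inj hrk (hx g) (hy g) h₂ h₄).1 ((e g).symm.trans hg)
  refine ⟨Quot.lift τ fun g g' h => ((hco g g').1 h).symm, ⟨?_, ?_⟩, ?_⟩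
  · rintro ⟨g⟩ ⟨g'⟩ h
    exact Quot.sound ((hco g g').2 h.symm)
  · rintro ⟨⟨u, hu⟩, ⟨z, hz⟩⟩
    have hm : z - D 1 0 u ∈ derCochain EB F E 𝔘 1 4 :=
      sub_mem hz.1 (hD.mem 1 0 (zero_mem _) u hu)
    have hg : exp24 u (z - D 1 0 u) ∈ Z1G EB F E 𝔘 := by
      refine (exp24_mem_Z1G_iff hrk hu.1.1 hm).2 ⟨hu.1, ?_⟩
      rw [map_sub, hD.coboundary 1 0 (zero_mem _) u hu, LinearMap.mem_ker.1 hz.2, zero_sub]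
    obtain ⟨e2, e4⟩ := hσ u hu.1.1 _ hm ⟨_, hg⟩ rfl
    refine ⟨H1G.mk 𝔘 ⟨_, hg⟩, Prod.ext ?_ ?_⟩
    · exact congrArg (ZtB.mk 𝔘) (Subtype.ext e2)
    · refine congrArg Submodule.Quotient.mk (Subtype.ext ?_)
      change D 1 0 (x _) + y _ = z
      rw [e2, e4, add_sub_cancel]
  · intro u₂ h₂ u₄ h₄ hg
    obtain ⟨e2, e4⟩ := hσ u₂ h₂ u₄ h₄ ⟨_, hg⟩ (expo_add hrk h₂ h₄)
    have k2 := hzt ⟨_, hg⟩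
    have k4 := hz4 ⟨_, hg⟩
    rw [e2] at k2
    rw [e2, e4] at k4
    refine ⟨k2, k4, Prod.ext ?_ ?_⟩
    · exact congrArg (ZtB.mk 𝔘) (Subtype.ext e2)
    · refine congrArg Submodule.Quotient.mk (Subtype.ext ?_)
      change D 1 0 (x _) + y _ = _
      rw [e2, e4]

theorem classification_equivariant
    {σ : H1G EB F E 𝔘 → ZtB EB F E 𝔘 × H1Der EB F E 𝔘 4}
    (hσ : ∀ u₂ ∈ derCochain EB F E 𝔘 1 2, ∀ u₄ ∈ derCochain EB F E 𝔘 1 4,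
      ∀ hg : expo 𝔘 (u₂ + u₄) ∈ Z1G EB F E 𝔘,
      ∃ (h₂ : u₂ ∈ Zt EB F E 𝔘) (h₄ : D 1 0 u₂ + u₄ ∈ Z1 EB F E 𝔘 4),
        σ (H1G.mk 𝔘 ⟨_, hg⟩) = (ZtB.mk 𝔘 ⟨u₂, h₂⟩, Submodule.Quotient.mk ⟨_, h₄⟩))
    (hinv : ∀ φ : AutE EB F E, ∀ u ∈ Zt EB F E 𝔘,
      act 𝔘 φ (D 1 0 u) - D 1 0 (act 𝔘 φ u) ∈ B1 EB F E 𝔘 4)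
    (φ : AutE EB F E) (c : H1G EB F E 𝔘) :
    σ (actH1G 𝔘 φ c) = (actZtB 𝔘 φ (σ c).1, actH1Der 𝔘 4 φ (σ c).2) := by
  obtain ⟨⟨g, hg⟩⟩ := c
  obtain ⟨⟨x, y⟩, ⟨hx, hy, rfl⟩, -⟩ := existsUnique_log 𝔘 hrk hg
  have e : act 𝔘 φ (expo 𝔘 (x + y)) = expo 𝔘 (act 𝔘 φ x + act 𝔘 φ y) := by
    rw [act_expo, map_add]
  have hg' : expo 𝔘 (act 𝔘 φ x + act 𝔘 φ y) ∈ Z1G EB F E 𝔘 := e ▸ act_Z1G 𝔘 φ hg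
  obtain ⟨h₂, h₄, h⟩ := hσ x hx y hy hg
  obtain ⟨h₂', h₄', h'⟩ := hσ _ (act_derCochain 𝔘 φ hx) _ (act_derCochain 𝔘 φ hy) hg'
  have ea : actH1G 𝔘 φ (H1G.mk 𝔘 ⟨_, hg⟩) = H1G.mk 𝔘 ⟨_, hg'⟩ :=
    congrArg (H1G.mk 𝔘) (Subtype.ext e)
  change σ (actH1G 𝔘 φ (H1G.mk 𝔘 ⟨_, hg⟩)) = (actZtB 𝔘 φ (σ (H1G.mk 𝔘 ⟨_, hg⟩)).1,
    actH1Der 𝔘 4 φ (σ (H1G.mk 𝔘 ⟨_, hg⟩)).2)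
  rw [ea, h, h']
  refine Prod.ext rfl ((Submodule.Quotient.eq _).2 ?_)
  change D 1 0 (act 𝔘 φ x) + act 𝔘 φ y - act 𝔘 φ (D 1 0 x + y) ∈ B1 EB F E 𝔘 4
  have h3 := neg_mem (hinv φ x h₂)
  convert h3 using 1
  rw [map_add]
  abel

end CechExp

end SplitSuper

end

theorem mainTheorem1
    {EB : Type*} [NormedAddCommGroup EB] [NormedSpace ℂ EB] [FiniteDimensional ℂ EB]
    {M : Type*} [TopologicalSpace M] [ChartedSpace EB M] [IsManifold 𝓘(ℂ, EB) ω M]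
    {F : Type*} [NormedAddCommGroup F] [NormedSpace ℂ F]
    {E : M → Type*} [∀ x, AddCommGroup (E x)] [∀ x, Module ℂ (E x)]
    [∀ x, TopologicalSpace (E x)] [TopologicalSpace (TotalSpace F E)] [FiberBundle F E]
    [VectorBundle ℂ F E] [ContMDiffVectorBundle ω F E 𝓘(ℂ, EB)]
    {J ι : Type*} [Preorder J] [IsDirectedOrder J] [Nonempty J]
    (𝔘 : SplitSuper.CoverSystem M J ι)
    (hrk : Module.finrank ℂ F = 4 ∨ Module.finrank ℂ F = 5)
    (hH0 : SplitSuper.Der EB F E 2 (⊤ : Opens M) = ⊥) :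
    -- strongly compatible maps exist
    (∃ D, SplitSuper.StronglyCompatible EB F E 𝔘 D) ∧
    -- every cocycle with values in `G_E` is `exp(u₂ + u₄)` for unique cochains `u₂`, `u₄`
    (∀ g ∈ SplitSuper.Z1G EB F E 𝔘,
      ∃! u : SplitSuper.Cochain EB F E 𝔘 1 × SplitSuper.Cochain EB F E 𝔘 1,
        u.1 ∈ SplitSuper.derCochain EB F E 𝔘 1 2 ∧ u.2 ∈ SplitSuper.derCochain EB F E 𝔘 1 4 ∧
        g = SplitSuper.expo 𝔘 (u.1 + u.2)) ∧
    -- every strongly compatible `D` defines a bijection `σ_D`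
    ∀ D, SplitSuper.StronglyCompatible EB F E 𝔘 D →
      ∃ σ : SplitSuper.H1G EB F E 𝔘 → SplitSuper.ZtB EB F E 𝔘 × SplitSuper.H1Der EB F E 𝔘 4,
        Function.Bijective σ ∧
        (∀ u₂ ∈ SplitSuper.derCochain EB F E 𝔘 1 2, ∀ u₄ ∈ SplitSuper.derCochain EB F E 𝔘 1 4,
          ∀ hg : SplitSuper.expo 𝔘 (u₂ + u₄) ∈ SplitSuper.Z1G EB F E 𝔘,
          ∃ (h₂ : u₂ ∈ SplitSuper.Zt EB F E 𝔘) (h₄ : D 1 0 u₂ + u₄ ∈ SplitSuper.Z1 EB F E 𝔘 4),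
            σ (SplitSuper.H1G.mk 𝔘 ⟨_, hg⟩) =
              (SplitSuper.ZtB.mk 𝔘 ⟨u₂, h₂⟩, Submodule.Quotient.mk ⟨_, h₄⟩)) ∧
        -- equivariance under an additional condition on `D`
        ((∀ φ : SplitSuper.AutE EB F E, ∀ u ∈ SplitSuper.Zt EB F E 𝔘,
            SplitSuper.act 𝔘 φ (D 1 0 u) - D 1 0 (SplitSuper.act 𝔘 φ u)
              ∈ SplitSuper.B1 EB F E 𝔘 4) →
          ∀ (φ : SplitSuper.AutE EB F E) (x : SplitSuper.H1G EB F E 𝔘),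
            σ (SplitSuper.actH1G 𝔘 φ x) =
              (SplitSuper.actZtB 𝔘 φ (σ x).1, SplitSuper.actH1Der 𝔘 4 φ (σ x).2)) := by
  refine ⟨SplitSuper.exists_stronglyCompatible 𝔘 hrk hH0,
    fun _ hg => SplitSuper.existsUnique_log 𝔘 hrk hg, fun D hD => ?_⟩
  obtain ⟨σ, hbij, hσ⟩ := SplitSuper.exists_classification hrk hD
  exact ⟨σ, hbij, hσ, SplitSuper.classification_equivariant hrk hσ⟩
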